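/- Let $d$ be a natural number and let $0 < \beta \le d$. Let $\mathbb{T}^d = \mathbb{R}^d/\mathbb{Z}^d$. For a finite Borel measure $\mu$ on $\mathbb{T}^d$ write $\widehat{\mu}(\xi) = \int e^{-2\pi i \xi\cdot x}\,d\mu(x)$ for $\xi \in \mathbb{Z}^d$, and for $\lambda \ge 0$ let $\|\mu\|_{M(\lambda)} = \sup_{\xi \in \mathbb{Z}^d} |\widehat{\mu}(\xi)|\,|\xi|^{\lambda/2}$. Let $M(\beta)$ be the set of finite Borel measures $\mu$ with $\|\mu\|_{M(\lambda)} < \infty$ for all $\lambda \in [0,\beta)$, with the topology given by the pseudometrics $\|\mu-\nu\|_{M(\lambda)} = \sup_{\xi}|\widehat{\mu}(\xi)-\widehat{\nu}(\xi)|\,|\xi|^{\lambda/2}$, $\lambda \in [0,\beta)$. Let $\mathcal{X}_\beta$ be the space of all pairs $(E,\mu)$ where $E \subset \mathbb{T}^d$ is compact and $\mu \in M(\beta)$ is a probability measure with $\operatorname{supp}(\mu) \subset E$, with the subspace topology of the product of the space of compact subsets of $\mathbb{T}^d$ (with the Hausdorff distance) and $M(\beta)$. The Fourier dimension of a finite Borel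 measure $\mu$ is the supremum of all $s \in [0,d]$ with $\sup_{\xi} |\widehat{\mu}(\xi)|\,|\xi|^{s/2} < \infty$; the Fourier dimension of a set $E$ is the supremum of the Fourier dimensions of all Borel probability measures $\mu$ with $\operatorname{supp}(\mu) \subset E$; and $E$ is a Salem set if its Fourier dimension equals its Hausdorff dimension. Then for quasi-all $(E,\mu) \in \mathcal{X}_\beta$ (that is, for all $(E,\mu)$ in a comeager subset of $\mathcal{X}_\beta$), the set $E$ is a Salem set of dimension exactly $\beta$: its Fourier dimension and its Hausdorff dimension both equal $\beta$. -/

import Mathlib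

open MeasureTheory TopologicalSpace Filter Topology
open scoped ENNReal NNReal

noncomputable section

namespace SalemGeneric

/-- The torus `𝕋^d = ℝ^d / ℤ^d`. (Its metric in Mathlib is the maximum metric, which is bi-Lipschitz
equivalent to the Euclidean one: Hausdorff dimensions and the topology given by the Hausdorff
distance are the same for both.) -/
abbrev Torus (d : ℕ) : Type := UnitAddTorus (Fin d)

/-- The Euclidean norm `|ξ|` of a frequency `ξ ∈ ℤ^d`. -/
def freqNorm {d : ℕ} (ξ : Fin d → ℤ) : ℝ :=
  ‖(WithLp.toLp 2 (fun i => (ξ i : ℝ)) : EuclideanSpace ℝ (Fin d))‖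

/-- The Fourier transform `μ̂(ξ) = ∫ exp(-2πi ξ·x) dμ(x)`, for `ξ ∈ ℤ^d`. -/
def fourierTransform {d : ℕ} (μ : Measure (Torus d)) (ξ : Fin d → ℤ) : ℂ :=
  ∫ x, UnitAddTorus.mFourier (-ξ) x ∂μ

/-- The weighted supremum `sup_ξ |f(ξ)| |ξ|^{l/2} ∈ [0,∞]` of a function `f` on `ℤ^d`. -/
def weightedSup {d : ℕ} (l : ℝ) (f : (Fin d → ℤ) → ℂ) : ℝ≥0∞ :=
  ⨆ ξ, ‖f ξ‖ₑ * ENNReal.ofReal (freqNorm ξ ^ (l / 2))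

/-- The seminorm `‖μ‖_{M(l)} = sup_ξ |μ̂(ξ)| |ξ|^{l/2}` (possibly infinite). -/
def fourierSeminorm {d : ℕ} (l : ℝ) (μ : Measure (Torus d)) : ℝ≥0∞ :=
  weightedSup l (fourierTransform μ)

/-- `‖μ - ν‖_{M(l)} = sup_ξ |μ̂(ξ) - ν̂(ξ)| |ξ|^{l/2}`. -/
def fourierSeminormDiff {d : ℕ} (l : ℝ) (μ ν : Measure (Torus d)) : ℝ≥0∞ :=
  weightedSup l (fun ξ => fourierTransform μ ξ - fourierTransform ν ξ)

theorem fourierSeminormDiff_self {d : ℕ} (l : ℝ) (μ : Measure (Torus d)) :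
    fourierSeminormDiff l μ μ = 0 := by
  simp [fourierSeminormDiff, weightedSup]

theorem fourierSeminormDiff_comm {d : ℕ} (l : ℝ) (μ ν : Measure (Torus d)) :
    fourierSeminormDiff l μ ν = fourierSeminormDiff l ν μ := by
  simp only [fourierSeminormDiff, weightedSup, enorm_sub_rev]

theorem fourierSeminormDiff_triangle {d : ℕ} (l : ℝ) (μ ν ρ : Measure (Torus d)) :
    fourierSeminormDiff l μ ρ ≤ fourierSeminormDiff l μ ν + fourierSeminormDiff l ν ρ := by
  refine iSup_le fun ξ => ?_
  have h : ‖fourierTransform μ ξ - fourierTransform ρ ξ‖ₑ ≤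
      ‖fourierTransform μ ξ - fourierTransform ν ξ‖ₑ +
        ‖fourierTransform ν ξ - fourierTransform ρ ξ‖ₑ := by
    have h0 := enorm_add_le (fourierTransform μ ξ - fourierTransform ν ξ)
      (fourierTransform ν ξ - fourierTransform ρ ξ)
    rwa [sub_add_sub_cancel] at h0
  refine (mul_le_mul_left h _).trans ?_
  rw [add_mul]
  exact add_le_add
    (le_iSup (fun ξ => ‖fourierTransform μ ξ - fourierTransform ν ξ‖ₑ *
      ENNReal.ofReal (freqNorm ξ ^ (l / 2))) ξ)
    (le_iSup (fun ξ => ‖fourierTransform ν ξ - fourierTransform ρ ξ‖ₑ *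
      ENNReal.ofReal (freqNorm ξ ^ (l / 2))) ξ)

/-- `M(β)`: the finite Borel measures `μ` on `𝕋^d` such that `‖μ‖_{M(l)} < ∞` for all
`l ∈ [0,β)`. -/
def MSpace (d : ℕ) (β : ℝ) : Type :=
  {μ : Measure (Torus d) //
    IsFiniteMeasure μ ∧ ∀ l : ℝ, 0 ≤ l → l < β → fourierSeminorm l μ < ∞}

/-- The pseudometric `(μ, ν) ↦ ‖μ - ν‖_{M(l)}` on `M(β)`. -/
@[reducible]
def MSpace.pseudoEMetric (d : ℕ) (β l : ℝ) : PseudoEMetricSpace (MSpace d β) where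
  edist μ ν := fourierSeminormDiff l μ.1 ν.1
  edist_self μ := fourierSeminormDiff_self l μ.1
  edist_comm μ ν := fourierSeminormDiff_comm l μ.1 ν.1
  edist_triangle μ ν ρ := fourierSeminormDiff_triangle l μ.1 ν.1 ρ.1

/-- The topology of `M(β)`: the one generated by all seminorms `‖·‖_{M(l)}`, `l ∈ [0,β)`. -/
instance MSpace.topology (d : ℕ) (β : ℝ) : TopologicalSpace (MSpace d β) :=
  ⨅ l : Set.Ico (0 : ℝ) β,
    (MSpace.pseudoEMetric d β l).toUniformSpace.toTopologicalSpace

/-- Convergence in `M(β)` is convergence in each seminorm `‖·‖_{M(l)}`, `l ∈ [0,β)`. -/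
theorem MSpace.tendsto_iff {d : ℕ} {β : ℝ} {ι : Type*} (F : Filter ι) (u : ι → MSpace d β)
    (μ : MSpace d β) :
    Tendsto u F (𝓝 μ) ↔
      ∀ l : ℝ, 0 ≤ l → l < β →
        Tendsto (fun i => fourierSeminormDiff l (u i).1 μ.1) F (𝓝 0) := by
  have key : ∀ l : ℝ,
      Tendsto u F (@nhds _ (MSpace.pseudoEMetric d β l).toUniformSpace.toTopologicalSpace μ) ↔
        Tendsto (fun i => fourierSeminormDiff l (u i).1 μ.1) F (𝓝 0) := fun l =>
    @tendsto_iff_edist_tendsto_0 _ _ (MSpace.pseudoEMetric d β l) F u μ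
  rw [nhds_iInf, tendsto_iInf]
  constructor
  · intro h l h0 h1
    exact (key l).1 (h ⟨l, h0, h1⟩)
  · intro h l
    exact (key l).2 (h l l.2.1 l.2.2)

/-- `𝒳_β`: the pairs `(E, μ)`, where `E ⊆ 𝕋^d` is compact and `μ ∈ M(β)` is a probability measure
with `supp μ ⊆ E`. It carries the subspace topology of the product of the space of compact
sets (with the Hausdorff distance) and `M(β)`. -/
def XSpace (d : ℕ) (β : ℝ) : Set (Compacts (Torus d) × MSpace d β) :=
  {p | IsProbabilityMeasure p.2.1 ∧ p.2.1.support ⊆ (p.1 : Set (Torus d))}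

/-- The Fourier dimension of a finite Borel measure `μ` on `𝕋^d`: the supremum of all `s ∈ [0,d]`
with `sup_ξ |μ̂(ξ)| |ξ|^{s/2} < ∞`. -/
def fourierDimMeasure {d : ℕ} (μ : Measure (Torus d)) : ℝ≥0∞ :=
  ⨆ (s : ℝ≥0) (_ : s ≤ d ∧ fourierSeminorm s μ < ∞), (s : ℝ≥0∞)

/-- The Fourier dimension of a set `E ⊆ 𝕋^d`: the supremum of the Fourier dimensions of all Borel
probability measures `μ` with `supp μ ⊆ E`. -/
def fourierDim {d : ℕ} (E : Set (Torus d)) : ℝ≥0∞ :=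
  ⨆ (μ : Measure (Torus d)) (_ : IsProbabilityMeasure μ ∧ μ.support ⊆ E), fourierDimMeasure μ

/-- A Salem set: its Fourier dimension agrees with its Hausdorff dimension. -/
def IsSalem {d : ℕ} (E : Set (Torus d)) : Prop :=
  fourierDim E = dimH E

end SalemGeneric

end

/-!
For the upper bound on the dimension of `E`, call a compact set `δ`-thin at exponent `t` if it is
covered by finitely many balls of one radius `r < δ` whose number times `r ^ t` is less than `δ`.
Thinness is an open condition, and a set that is `δ`-thin at exponent `t` for every `δ > 0` has
Hausdorff dimension at most `t`. By Baire it suffices that the pairs `(E, μ)` with `E` thin are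
dense for each `t > β`. Given `(E, μ)` and `l < b < β`, draw about `M ^ b` independent points from
`μ`. Hoeffding's inequality and a union bound over the polynomially many frequencies `|ξ| ≤ M`
yield a sample whose Fourier transform differs from `μ̂` by a small multiple of `M ^ (-l / 2)` at
all of them. Convolving with a smooth bump at scale `M ^ (-a)`, where `b / t < a < 1`, kills the
frequencies `|ξ| > M` and barely affects the lower ones, so the result is close to `μ` in `M(l)`. It
is carried by `M ^ b` balls of radius `M ^ (-a)`, and `M ^ (b - a * t)` tends to `0`.

For the lower bound, `μ ∈ M(β)` gives Fourier dimension at least `β` for every pair, and the Fourier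
dimension never exceeds the Hausdorff dimension: integrating the square of a Dirichlet kernel of
order `1 / r` in `x - y` turns decay of `μ̂` into `(μ × μ) {|x - y| ≤ r} ≤ C * r ^ t`, so `μ` has
finite energy at every smaller exponent, and then `μ` divided by its Riesz potential is a measure
dominated by Hausdorff measure.
-/

noncomputable section

namespace SalemGeneric

section Sampling

open ProbabilityTheory

variable {α ι : Type*} [MeasurableSpace α] [Fintype ι] (μ : Measure α) [IsProbabilityMeasure μ]

theorem measureReal_pi_sum_sub_integral_ge_le {f : α → ℝ} (hf : Measurable f)
    (hb : ∀ x, |f x| ≤ 1) {ε : ℝ} (hε : 0 ≤ ε) :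
    (Measure.pi fun _ : ι => μ).real {X | ε ≤ ∑ j, (f (X j) - ∫ x, f x ∂μ)} ≤
      Real.exp (-(ε ^ 2 / (2 * Fintype.card ι))) := by
  have hparam : ((‖(1 : ℝ) - (-1)‖₊ / 2) ^ 2 : ℝ≥0) = 1 := by
    ext; norm_num
  have hsub : HasSubgaussianMGF (fun x => f x - ∫ x, f x ∂μ) 1 μ :=
    hparam ▸ hasSubgaussianMGF_of_mem_Icc hf.aemeasurable (ae_of_all _ fun x => abs_le.1 (hb x))
  have hind : iIndepFun (fun (j : ι) (X : ι → α) => f (X j) - ∫ x, f x ∂μ)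
      (Measure.pi fun _ => μ) :=
    iIndepFun_pi (X := fun _ x => f x - ∫ x, f x ∂μ) fun _ => (hf.sub_const _).aemeasurable
  have hcoord (j : ι) : HasSubgaussianMGF (fun X : ι → α => f (X j) - ∫ x, f x ∂μ) 1
      (Measure.pi fun _ => μ) := by
    have hmp := measurePreserving_eval (fun _ : ι => μ) j
    exact HasSubgaussianMGF.of_map (X := fun x => f x - ∫ x, f x ∂μ)
      hmp.measurable.aemeasurable (hmp.map_eq.symm ▸ hsub)
  have hsum := HasSubgaussianMGF.measure_sum_ge_le_of_iIndepFun hind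
    (s := Finset.univ) (fun j _ => hcoord j) hε
  simpa [neg_div] using hsum

theorem measureReal_pi_abs_sum_sub_integral_ge_le {f : α → ℝ} (hf : Measurable f)
    (hb : ∀ x, |f x| ≤ 1) {ε : ℝ} (hε : 0 ≤ ε) :
    (Measure.pi fun _ : ι => μ).real {X | ε ≤ |∑ j, (f (X j) - ∫ x, f x ∂μ)|} ≤
      2 * Real.exp (-(ε ^ 2 / (2 * Fintype.card ι))) := by
  have hupper := measureReal_pi_sum_sub_integral_ge_le (ι := ι) μ hf hb hε
  have hlower := measureReal_pi_sum_sub_integral_ge_le (ι := ι) μ hf.neg (by simpa using hb) hε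
  have hsub : {X : ι → α | ε ≤ |∑ j, (f (X j) - ∫ x, f x ∂μ)|} ⊆
      {X | ε ≤ ∑ j, (f (X j) - ∫ x, f x ∂μ)} ∪
        {X | ε ≤ ∑ j, ((-f) (X j) - ∫ x, (-f) x ∂μ)} := by
    intro X hX
    refine (le_abs.1 (Set.mem_ofPred_eq ▸ hX)).imp id fun h => le_of_le_of_eq h ?_
    rw [← Finset.sum_neg_distrib]
    refine Finset.sum_congr rfl fun _ _ => ?_
    simp only [Pi.neg_apply, integral_neg]
    ring
  calc _ ≤ _ := measureReal_mono hsub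
    _ ≤ _ := measureReal_union_le _ _
    _ ≤ _ := by linarith

theorem measureReal_pi_norm_sum_sub_integral_ge_le {f : α → ℂ} (hf : Measurable f)
    (hb : ∀ x, ‖f x‖ ≤ 1) {ε : ℝ} (hε : 0 ≤ ε) :
    (Measure.pi fun _ : ι => μ).real {X | 2 * ε ≤ ‖∑ j, (f (X j) - ∫ x, f x ∂μ)‖} ≤
      4 * Real.exp (-(ε ^ 2 / (2 * Fintype.card ι))) := by
  have hint : Integrable f μ := .of_bound hf.aestronglyMeasurable 1 (ae_of_all _ hb)
  have hre := measureReal_pi_abs_sum_sub_integral_ge_le (ι := ι) μ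
    (Complex.measurable_re.comp hf) (fun x => (Complex.abs_re_le_norm _).trans (hb x)) hε
  have him := measureReal_pi_abs_sum_sub_integral_ge_le (ι := ι) μ
    (Complex.measurable_im.comp hf) (fun x => (Complex.abs_im_le_norm _).trans (hb x)) hε
  have hsub : {X : ι → α | 2 * ε ≤ ‖∑ j, (f (X j) - ∫ x, f x ∂μ)‖} ⊆
      {X | ε ≤ |∑ j, ((f (X j)).re - ∫ x, (f x).re ∂μ)|} ∪
        {X | ε ≤ |∑ j, ((f (X j)).im - ∫ x, (f x).im ∂μ)|} := by
    intro X hX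
    have hnorm := le_trans hX (Complex.norm_le_abs_re_add_abs_im _)
    have hr : ∫ x, (f x).re ∂μ = (∫ x, f x ∂μ).re := integral_re hint
    have hi : ∫ x, (f x).im ∂μ = (∫ x, f x ∂μ).im := integral_im hint
    rw [Complex.re_sum, Complex.im_sum] at hnorm
    simp only [Set.mem_union, Set.mem_ofPred_eq, hr, hi, ← Complex.sub_re, ← Complex.sub_im]
    by_contra! hlt
    linarith [hlt.1, hlt.2]
  calc _ ≤ _ := measureReal_mono hsub
    _ ≤ _ := measureReal_union_le _ _
    _ ≤ _ := by simp only [Function.comp_def] at hre him; linarith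

theorem exists_sample_norm_sum_sub_integral_lt {κ : Type*} {f : κ → α → ℂ} {S : Finset κ}
    (hf : ∀ k ∈ S, Measurable (f k)) (hb : ∀ k ∈ S, ∀ x, ‖f k x‖ ≤ 1) {E : Set α}
    (hE : ∀ᵐ x ∂μ, x ∈ E) {ε : ℝ} (hε : 0 ≤ ε)
    (hS : S.card * (4 * Real.exp (-(ε ^ 2 / (2 * Fintype.card ι)))) < 1) :
    ∃ X : ι → α, (∀ j, X j ∈ E) ∧
      ∀ k ∈ S, ‖∑ j, (f k (X j) - ∫ x, f k x ∂μ)‖ < 2 * ε := by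
  let P : Measure (ι → α) := Measure.pi fun _ => μ
  let bad : Set (ι → α) := ⋃ k ∈ S, {X | 2 * ε ≤ ‖∑ j, (f k (X j) - ∫ x, f k x ∂μ)‖}
  have hbad : P.real bad < 1 := by
    refine (measureReal_biUnion_finset_le _ _).trans_lt (hS.trans_le' ?_)
    rw [← nsmul_eq_mul]
    exact Finset.sum_le_card_nsmul _ _ _ fun k hk =>
      measureReal_pi_norm_sum_sub_integral_ge_le μ (hf k hk) (hb k hk) hε
  have hmem : ∀ᵐ X ∂P, ∀ j, X j ∈ E := eventually_countable_forall.2 fun j =>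
    (measurePreserving_eval (fun _ : ι => μ) j).quasiMeasurePreserving.ae hE
  obtain ⟨X, hX, hXE⟩ : ∃ X, X ∉ bad ∧ ∀ j, X j ∈ E := by
    by_contra! hcon
    have hall : bad =ᵐ[P] Set.univ := eventuallyEq_univ.2 <| by
      filter_upwards [hmem] with X hX
      by_contra hXbad
      obtain ⟨j, hj⟩ := hcon X hXbad
      exact hj (hX j)
    rw [measureReal_congr hall, probReal_univ] at hbad
    exact lt_irrefl _ hbad
  refine ⟨X, hXE, fun k hk => not_le.1 fun hle => hX ?_⟩
  exact Set.mem_biUnion hk hle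

end Sampling

section FrequencyNorm

variable {d : ℕ}

theorem freqNorm_nonneg (ξ : Fin d → ℤ) : 0 ≤ freqNorm ξ := norm_nonneg _

theorem abs_le_freqNorm (ξ : Fin d → ℤ) (i : Fin d) : |(ξ i : ℝ)| ≤ freqNorm ξ := by
  simpa [freqNorm] using
    PiLp.norm_apply_le (WithLp.toLp 2 fun i => (ξ i : ℝ) : EuclideanSpace ℝ (Fin d)) i

theorem norm_le_freqNorm (ξ : Fin d → ℤ) : ‖ξ‖ ≤ freqNorm ξ :=
  (pi_norm_le_iff_of_nonneg (freqNorm_nonneg ξ)).2 fun i => by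
    simpa [Int.norm_eq_abs] using abs_le_freqNorm ξ i

theorem one_le_freqNorm {ξ : Fin d → ℤ} (hξ : ξ ≠ 0) : 1 ≤ freqNorm ξ := by
  obtain ⟨i, hi⟩ := Function.ne_iff.1 hξ
  refine le_trans ?_ (abs_le_freqNorm ξ i)
  exact_mod_cast Int.one_le_abs hi

/-- The finite set of frequencies `ξ ∈ ℤ^d` with `|ξ| ≤ M`. -/
def freqBall (d M : ℕ) : Finset (Fin d → ℤ) :=
  (Fintype.piFinset fun _ => Finset.Icc (-M : ℤ) M).filter fun ξ => freqNorm ξ ≤ M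

theorem mem_freqBall {M : ℕ} {ξ : Fin d → ℤ} : ξ ∈ freqBall d M ↔ freqNorm ξ ≤ M := by
  refine ⟨fun h => (Finset.mem_filter.1 h).2, fun h => Finset.mem_filter.2 ⟨?_, h⟩⟩
  refine Fintype.mem_piFinset.2 fun i => Finset.mem_Icc.2 (abs_le.1 ?_)
  exact_mod_cast (abs_le_freqNorm ξ i).trans h

theorem card_freqBall_le (d M : ℕ) : (freqBall d M).card ≤ (2 * M + 1) ^ d := by
  refine (Finset.card_filter_le _ _).trans_eq ?_
  rw [Fintype.card_piFinset_const, Int.card_Icc]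
  congr 1
  omega

end FrequencyNorm

section WeightedSup

variable {d : ℕ} {l : ℝ} {f g : (Fin d → ℤ) → ℂ}

theorem weightedSup_le_ofReal {C : ℝ} (h : ∀ ξ, ‖f ξ‖ * freqNorm ξ ^ (l / 2) ≤ C) :
    weightedSup l f ≤ ENNReal.ofReal C := by
  refine iSup_le fun ξ => ?_
  rw [← ofReal_norm, ← ENNReal.ofReal_mul (norm_nonneg _)]
  exact ENNReal.ofReal_le_ofReal (h ξ)

theorem weightedSup_lt_top_of_forall_ne_zero {C : ℝ}
    (h : ∀ ξ, ξ ≠ 0 → ‖f ξ‖ * freqNorm ξ ^ (l / 2) ≤ C) : weightedSup l f < ∞ := by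
  refine (weightedSup_le_ofReal (C := max C (‖f 0‖ * freqNorm (0 : Fin d → ℤ) ^ (l / 2)))
    fun ξ => ?_).trans_lt ENNReal.ofReal_lt_top
  rcases eq_or_ne ξ 0 with rfl | hξ
  · exact le_max_right _ _
  · exact (h ξ hξ).trans (le_max_left _ _)

theorem norm_mul_rpow_le_toReal_weightedSup (h : weightedSup l f < ∞) (ξ : Fin d → ℤ) :
    ‖f ξ‖ * freqNorm ξ ^ (l / 2) ≤ (weightedSup l f).toReal := by
  rw [← ENNReal.ofReal_le_iff_le_toReal h.ne, ENNReal.ofReal_mul (norm_nonneg _), ofReal_norm]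
  exact le_iSup (fun ξ => ‖f ξ‖ₑ * ENNReal.ofReal (freqNorm ξ ^ (l / 2))) ξ

theorem weightedSup_add_le : weightedSup l (f + g) ≤ weightedSup l f + weightedSup l g := by
  refine iSup_le fun ξ => ?_
  calc ‖f ξ + g ξ‖ₑ * ENNReal.ofReal (freqNorm ξ ^ (l / 2))
      ≤ (‖f ξ‖ₑ + ‖g ξ‖ₑ) * ENNReal.ofReal (freqNorm ξ ^ (l / 2)) := by
        gcongr
        exact enorm_add_le _ _
    _ ≤ weightedSup l f + weightedSup l g := by
        rw [add_mul]
        exact add_le_add (le_iSup_of_le ξ le_rfl) (le_iSup_of_le ξ le_rfl)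

theorem weightedSup_mono {l' : ℝ} (hll' : l ≤ l') (h0 : f 0 = 0) :
    weightedSup l f ≤ weightedSup l' f := by
  refine iSup_mono fun ξ => ?_
  rcases eq_or_ne ξ 0 with rfl | hξ
  · simp [h0]
  · gcongr
    exact one_le_freqNorm hξ

end WeightedSup

section FourierTransform

variable {d : ℕ} (μ ν : Measure (Torus d))

theorem norm_mFourier_apply_le (ξ : Fin d → ℤ) (x : Torus d) :
    ‖UnitAddTorus.mFourier ξ x‖ ≤ 1 :=
  ((UnitAddTorus.mFourier ξ).norm_coe_le_norm x).trans_eq UnitAddTorus.mFourier_norm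

theorem mFourier_apply_add (ξ : Fin d → ℤ) (x y : Torus d) :
    UnitAddTorus.mFourier ξ (x + y) = UnitAddTorus.mFourier ξ x * UnitAddTorus.mFourier ξ y := by
  simp [UnitAddTorus.mFourier, fourier_apply, AddCircle.toCircle_add, Finset.prod_mul_distrib]

theorem integrable_mFourier [IsFiniteMeasure μ] (ξ : Fin d → ℤ) :
    Integrable (fun x => UnitAddTorus.mFourier ξ x) μ :=
  .of_bound (UnitAddTorus.mFourier ξ).continuous.aestronglyMeasurable 1
    (ae_of_all _ (norm_mFourier_apply_le ξ))

theorem norm_fourierTransform_le [IsFiniteMeasure μ] (ξ : Fin d → ℤ) :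
    ‖fourierTransform μ ξ‖ ≤ μ.real Set.univ := by
  simpa [fourierTransform] using norm_integral_le_of_norm_le_const (μ := μ)
    (ae_of_all _ (norm_mFourier_apply_le (-ξ)))

theorem fourierTransform_zero : fourierTransform μ 0 = μ.real Set.univ := by
  simp [fourierTransform, UnitAddTorus.mFourier_zero]

theorem fourierTransform_conv [IsFiniteMeasure μ] [IsFiniteMeasure ν] (ξ : Fin d → ℤ) :
    fourierTransform (μ ∗ ν) ξ = fourierTransform μ ξ * fourierTransform ν ξ := by
  rw [fourierTransform, integral_conv (integrable_mFourier _ _)]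
  simp only [mFourier_apply_add, integral_const_mul, integral_mul_const]
  rfl

end FourierTransform

section Convolution

theorem ae_conv_of_forall_add_mem {M : Type*} [AddMonoid M] [MeasurableSpace M] [MeasurableAdd₂ M]
    {μ ν : Measure M} [SFinite μ] [SFinite ν] {A B C : Set M} (hA : ∀ᵐ x ∂μ, x ∈ A)
    (hB : ∀ᵐ x ∂ν, x ∈ B) (hC : MeasurableSet C) (hadd : ∀ x ∈ A, ∀ y ∈ B, x + y ∈ C) :
    ∀ᵐ x ∂(μ ∗ ν), x ∈ C := by
  rw [Measure.conv, ae_map_iff (p := fun x => x ∈ C) (by fun_prop) hC]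
  filter_upwards [Measure.quasiMeasurePreserving_fst.ae hA,
    Measure.quasiMeasurePreserving_snd.ae hB] with p h1 h2 using hadd _ h1 _ h2

end Convolution

section Mollifier

open scoped FourierTransform SchwartzMap ContDiff

/-- A smooth bump function supported in the unit ball of `ℝ^d`, the profile of `mollifier`. -/
def unitBump (d : ℕ) : ContDiffBump (0 : EuclideanSpace ℝ (Fin d)) where
  rIn := 1 / 2
  rOut := 1
  rIn_pos := by norm_num
  rIn_lt_rOut := by norm_num

/-- The density proportional to `unitBump d` of total mass `1`, as a complex Schwartz function. -/
def bumpDensity (d : ℕ) : 𝓢(EuclideanSpace ℝ (Fin d), ℂ) :=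
  ((unitBump d).hasCompactSupport_normed (μ := volume) |>.comp_left
    (g := Complex.ofReal) Complex.ofReal_zero).toSchwartzMap
    (Complex.ofRealCLM.contDiff.comp (unitBump d).contDiff_normed)

/-- The smooth probability measure on `𝕋^d` at scale `h`: the law of `h Y mod 1`, where the random
vector `Y` has density `bumpDensity d` on `ℝ^d`. -/
def mollifier (d : ℕ) (h : ℝ) : Measure (Torus d) :=
  (volume.withDensity fun x => ENNReal.ofReal ((unitBump d).normed volume x)).map
    fun x i => ((h * x i : ℝ) : UnitAddCircle)

theorem measurable_coe_mul (d : ℕ) (h : ℝ) :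
    Measurable fun (x : EuclideanSpace ℝ (Fin d)) i => ((h * x i : ℝ) : UnitAddCircle) :=
  Continuous.measurable <| continuous_pi fun i => (AddCircle.continuous_mk' 1).comp (by fun_prop)

instance (d : ℕ) (h : ℝ) : IsProbabilityMeasure (mollifier d h) := by
  have : IsProbabilityMeasure
      (volume.withDensity fun x => ENNReal.ofReal ((unitBump d).normed volume x)) := by
    refine ⟨?_⟩
    rw [withDensity_apply _ MeasurableSet.univ, setLIntegral_univ,
      ← ofReal_integral_eq_lintegral_ofReal (unitBump d).integrable_normed
        (ae_of_all _ (unitBump d).nonneg_normed), (unitBump d).integral_normed, ENNReal.ofReal_one]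
  exact Measure.isProbabilityMeasure_map (measurable_coe_mul d h).aemeasurable

theorem ae_norm_le_mollifier (d : ℕ) {h : ℝ} (hh : 0 ≤ h) : ∀ᵐ x ∂mollifier d h, ‖x‖ ≤ h := by
  have hdens : Measurable fun x => ENNReal.ofReal ((unitBump d).normed volume x) :=
    (unitBump d).continuous_normed.measurable.ennreal_ofReal
  rw [mollifier, ae_map_iff (measurable_coe_mul d h).aemeasurable
    (measurableSet_le measurable_norm measurable_const), ae_withDensity_iff hdens]
  refine ae_of_all _ fun x hx => (pi_norm_le_iff_of_nonneg hh).2 fun i => ?_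
  have hx1 : ‖x‖ ≤ 1 := by
    have : x ∈ Function.support ((unitBump d).normed volume) := fun h0 => hx (by simp [h0])
    rw [(unitBump d).support_normed_eq, mem_ball_zero_iff] at this
    exact this.le
  calc ‖((h * x i : ℝ) : UnitAddCircle)‖ ≤ ‖h * x i‖ := QuotientAddGroup.norm_mk_le_norm
    _ = h * ‖x i‖ := by rw [norm_mul, Real.norm_of_nonneg hh]
    _ ≤ h * 1 := by gcongr; exact (PiLp.norm_apply_le x i).trans hx1
    _ = h := mul_one h

theorem fourierTransform_mollifier {d : ℕ} (h : ℝ) (ξ : Fin d → ℤ) :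
    fourierTransform (mollifier d h) ξ =
      𝓕 (bumpDensity d) (h • WithLp.toLp 2 fun i => (ξ i : ℝ)) := by
  have hdens : Measurable fun x => ENNReal.ofReal ((unitBump d).normed volume x) :=
    (unitBump d).continuous_normed.measurable.ennreal_ofReal
  rw [fourierTransform, mollifier, integral_map (measurable_coe_mul d h).aemeasurable
      (UnitAddTorus.mFourier (-ξ)).continuous.aestronglyMeasurable,
    integral_withDensity_eq_integral_toReal_smul hdens (ae_of_all _ fun _ => ENNReal.ofReal_lt_top),
    SchwartzMap.fourier_coe, Real.fourier_eq']
  refine integral_congr_ae (ae_of_all _ fun x => ?_)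
  have hchar : UnitAddTorus.mFourier (-ξ) (fun i => ((h * x i : ℝ) : UnitAddCircle)) =
      Complex.exp (((-2 * Real.pi * inner ℝ x (h • WithLp.toLp 2 fun i => (ξ i : ℝ)) : ℝ) : ℂ) *
        Complex.I) := by
    simp only [UnitAddTorus.mFourier, ContinuousMap.coe_mk, fourier_coe_apply, ← Complex.exp_sum,
      PiLp.inner_apply]
    congr 1
    push_cast [Finset.mul_sum, Finset.sum_mul]
    refine Finset.sum_congr rfl fun i _ => ?_
    simp
    ring
  simp only [hchar, ENNReal.toReal_ofReal ((unitBump d).nonneg_normed x), bumpDensity,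
    Complex.real_smul, smul_eq_mul]
  exact mul_comm _ _

theorem tendsto_fourierTransform_mollifier {d : ℕ} (ξ : Fin d → ℤ) :
    Tendsto (fun h => fourierTransform (mollifier d h) ξ) (𝓝 0) (𝓝 1) := by
  have hprofile : 𝓕 (bumpDensity d) 0 = 1 := by
    have hzero := fourierTransform_mollifier (d := d) 0 0
    rwa [zero_smul, fourierTransform_zero, probReal_univ, Complex.ofReal_one, eq_comm] at hzero
  have hcont : Continuous fun h : ℝ => 𝓕 (bumpDensity d) (h • WithLp.toLp 2 fun i => (ξ i : ℝ)) :=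
    (𝓕 (bumpDensity d)).continuous.comp (by fun_prop)
  simpa only [fourierTransform_mollifier, zero_smul, hprofile] using hcont.tendsto 0

theorem exists_norm_fourierTransform_mollifier_mul_le (d K : ℕ) :
    ∃ C, ∀ (h : ℝ) (ξ : Fin d → ℤ),
      ‖fourierTransform (mollifier d h) ξ‖ * (|h| * freqNorm ξ) ^ K ≤ C := by
  obtain ⟨C, -, hC⟩ := (𝓕 (bumpDensity d)).decay K 0
  refine ⟨C, fun h ξ => ?_⟩
  have hdecay := hC (h • WithLp.toLp 2 fun i => (ξ i : ℝ))
  rw [norm_iteratedFDeriv_zero, norm_smul, ← fourierTransform_mollifier, mul_comm] at hdecay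
  exact hdecay

end Mollifier

section Empirical

variable {d N : ℕ}

/-- The uniform probability measure on the points `X j`, counted with multiplicity. -/
def empiricalMeasure (X : Fin N → Torus d) : Measure (Torus d) :=
  (N : ℝ≥0∞)⁻¹ • ∑ j, Measure.dirac (X j)

instance [NeZero N] (X : Fin N → Torus d) : IsProbabilityMeasure (empiricalMeasure X) := by
  refine ⟨?_⟩
  simp only [empiricalMeasure, Measure.smul_apply, Measure.finsetSum_apply, measure_univ,
    Finset.sum_const, Finset.card_univ, Fintype.card_fin, nsmul_eq_mul, mul_one, smul_eq_mul]
  exact ENNReal.inv_mul_cancel (by simp [NeZero.ne N]) (by simp)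

theorem fourierTransform_empiricalMeasure (X : Fin N → Torus d) (ξ : Fin d → ℤ) :
    fourierTransform (empiricalMeasure X) ξ =
      (N : ℂ)⁻¹ * ∑ j, UnitAddTorus.mFourier (-ξ) (X j) := by
  rw [fourierTransform, empiricalMeasure, integral_smul_measure,
    integral_finsetSum_measure fun j _ => integrable_mFourier _ _]
  simp

theorem ae_empiricalMeasure_mem_range (X : Fin N → Torus d) :
    ∀ᵐ x ∂empiricalMeasure X, x ∈ Set.range X := by
  refine Measure.ae_smul_measure ?_ _
  rw [ae_iff, Measure.finsetSum_apply]
  refine Finset.sum_eq_zero fun j _ => ?_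
  rw [← ae_iff, ae_dirac_eq]
  exact ⟨j, rfl⟩

theorem exists_sample_norm_fourierTransform_sub_le [NeZero N] (μ : Measure (Torus d))
    [IsProbabilityMeasure μ] {E : Set (Torus d)} (hE : ∀ᵐ x ∂μ, x ∈ E) (S : Finset (Fin d → ℤ))
    {s : ℝ} (hs : 0 ≤ s) (hS : S.card * (4 * Real.exp (-(N * s ^ 2 / 2))) < 1) :
    ∃ X : Fin N → Torus d, (∀ j, X j ∈ E) ∧ ∀ ξ ∈ S,
      ‖fourierTransform (empiricalMeasure X) ξ - fourierTransform μ ξ‖ ≤ 2 * s := by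
  have hN : (0 : ℝ) < N := Nat.cast_pos.2 (NeZero.pos N)
  have hexp : (N * s) ^ 2 / (2 * Fintype.card (Fin N)) = N * s ^ 2 / 2 := by
    rw [Fintype.card_fin]
    field_simp
  obtain ⟨X, hXE, hX⟩ := exists_sample_norm_sum_sub_integral_lt μ (ι := Fin N)
    (f := fun ξ x => UnitAddTorus.mFourier (-ξ) x) (S := S) (ε := N * s)
    (fun ξ _ => (UnitAddTorus.mFourier (-ξ)).continuous.measurable)
    (fun ξ _ => norm_mFourier_apply_le (-ξ)) hE (by positivity) (by rwa [hexp])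
  refine ⟨X, hXE, fun ξ hξ => ?_⟩
  have hsum : fourierTransform (empiricalMeasure X) ξ - fourierTransform μ ξ =
      (N : ℂ)⁻¹ * ∑ j, (UnitAddTorus.mFourier (-ξ) (X j) - fourierTransform μ ξ) := by
    have : (N : ℂ) ≠ 0 := NeZero.ne _
    rw [fourierTransform_empiricalMeasure, Finset.sum_sub_distrib, Finset.sum_const,
      Finset.card_univ, Fintype.card_fin, nsmul_eq_mul]
    field_simp
  rw [hsum, norm_mul, norm_inv, Complex.norm_natCast, inv_mul_le_iff₀ hN]
  exact (hX ξ hξ).le.trans_eq (by ring)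

end Empirical

section Approximation

variable {d : ℕ}

theorem tendsto_natCast_rpow_neg {p : ℝ} (hp : 0 < p) :
    Tendsto (fun M : ℕ => (M : ℝ) ^ (-p)) atTop (𝓝 0) :=
  (tendsto_rpow_neg_atTop hp).comp tendsto_natCast_atTop_atTop

theorem eventually_weightedSup_mul_le {ι : Type*} {F : Filter ι} {f : (Fin d → ℤ) → ℂ}
    {g : ι → (Fin d → ℤ) → ℂ} {l l' B : ℝ} (hll' : l < l') (hf : weightedSup l' f < ∞)
    (hg : ∀ ξ, Tendsto (fun i => g i ξ) F (𝓝 0)) (hB : ∀ i ξ, ‖g i ξ‖ ≤ B) {ε : ℝ} (hε : 0 < ε) :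
    ∀ᶠ i in F, weightedSup l (fun ξ => g i ξ * f ξ) ≤ ENNReal.ofReal ε := by
  set C := (weightedSup l' f).toReal
  have hlim : Tendsto (fun M : ℕ => B * C * (M : ℝ) ^ (-((l' - l) / 2))) atTop (𝓝 0) := by
    simpa using (tendsto_natCast_rpow_neg (p := (l' - l) / 2) (by linarith)).const_mul (B * C)
  obtain ⟨M, hM, hM1⟩ := ((hlim.eventually (ge_mem_nhds hε)).and (eventually_ge_atTop 1)).exists
  have hM0 : (0 : ℝ) < M := by exact_mod_cast hM1
  have hlow : ∀ᶠ i in F, ∀ ξ ∈ freqBall d M, ‖g i ξ * f ξ‖ * freqNorm ξ ^ (l / 2) ≤ ε := by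
    refine (Filter.eventually_all_finset _).2 fun ξ _ => ?_
    have hξ := (((hg ξ).mul_const (f ξ)).norm).mul_const (freqNorm ξ ^ (l / 2))
    rw [zero_mul, norm_zero, zero_mul] at hξ
    exact hξ.eventually (ge_mem_nhds hε)
  filter_upwards [hlow] with i hi
  refine weightedSup_le_ofReal fun ξ => ?_
  by_cases hξ : ξ ∈ freqBall d M
  · exact hi ξ hξ
  have hlt : (M : ℝ) < freqNorm ξ := not_le.1 (mt mem_freqBall.2 hξ)
  have hsplit : freqNorm ξ ^ (l / 2) = freqNorm ξ ^ (l' / 2) * freqNorm ξ ^ (-((l' - l) / 2)) := by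
    rw [← Real.rpow_add (hM0.trans hlt)]
    congr 1
    ring
  calc ‖g i ξ * f ξ‖ * freqNorm ξ ^ (l / 2)
      = ‖g i ξ‖ * (‖f ξ‖ * freqNorm ξ ^ (l' / 2)) * freqNorm ξ ^ (-((l' - l) / 2)) := by
        rw [norm_mul, hsplit]
        ring
    _ ≤ B * C * (M : ℝ) ^ (-((l' - l) / 2)) := by
        have hB0 : 0 ≤ B := (norm_nonneg _).trans (hB i ξ)
        have hfC := norm_mul_rpow_le_toReal_weightedSup hf ξ
        have hdecay : freqNorm ξ ^ (-((l' - l) / 2)) ≤ (M : ℝ) ^ (-((l' - l) / 2)) :=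
          Real.rpow_le_rpow_of_nonpos hM0 hlt.le (by linarith)
        have := freqNorm_nonneg ξ
        gcongr
        exact hB i ξ
    _ ≤ ε := hM

theorem weightedSup_mul_le_ofReal_of_cutoff {f g : (Fin d → ℤ) → ℂ} {l B M ε : ℝ}
    (hf : ∀ ξ, ‖f ξ‖ ≤ 1) (hg : ∀ ξ, ‖g ξ‖ ≤ B)
    (hlow : ∀ ξ, freqNorm ξ ≤ M → ‖g ξ‖ * freqNorm ξ ^ (l / 2) ≤ ε)
    (hhigh : ∀ ξ, M < freqNorm ξ → B * (‖f ξ‖ * freqNorm ξ ^ (l / 2)) ≤ ε) :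
    weightedSup l (fun ξ => f ξ * g ξ) ≤ ENNReal.ofReal ε := by
  refine weightedSup_le_ofReal fun ξ => ?_
  have hweight : 0 ≤ freqNorm ξ ^ (l / 2) := Real.rpow_nonneg (freqNorm_nonneg ξ) _
  rw [norm_mul]
  rcases le_or_gt (freqNorm ξ) M with hξ | hξ
  · rw [mul_assoc]
    exact (mul_le_of_le_one_left (by positivity) (hf ξ)).trans (hlow ξ hξ)
  · calc ‖f ξ‖ * ‖g ξ‖ * freqNorm ξ ^ (l / 2)
        = ‖g ξ‖ * (‖f ξ‖ * freqNorm ξ ^ (l / 2)) := by ring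
      _ ≤ B * (‖f ξ‖ * freqNorm ξ ^ (l / 2)) := by
        gcongr
        exact hg ξ
      _ ≤ ε := hhigh ξ hξ

theorem eventually_norm_fourierTransform_mollifier_mul_le (d : ℕ) {a : ℝ} (ha : a < 1) (p : ℝ)
    {ε : ℝ} (hε : 0 < ε) :
    ∀ᶠ M : ℕ in atTop, ∀ ξ : Fin d → ℤ, M < freqNorm ξ →
      ‖fourierTransform (mollifier d ((M : ℝ) ^ (-a))) ξ‖ * freqNorm ξ ^ p ≤ ε := by
  obtain ⟨K, hK⟩ := exists_nat_gt (max p (p / (1 - a)))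
  obtain ⟨hpK, hpaK⟩ := max_lt_iff.1 hK
  have hexp : 0 < (1 - a) * K - p := by
    rw [div_lt_iff₀ (by linarith)] at hpaK
    linarith
  obtain ⟨C, hC⟩ := exists_norm_fourierTransform_mollifier_mul_le d K
  have hlim : Tendsto (fun M : ℕ => C * (M : ℝ) ^ (-((1 - a) * K - p))) atTop (𝓝 0) := by
    simpa using (tendsto_natCast_rpow_neg hexp).const_mul C
  filter_upwards [hlim.eventually (ge_mem_nhds hε), eventually_gt_atTop 0] with M hM hMpos ξ hξ
  have hM0 : (0 : ℝ) < M := Nat.cast_pos.2 hMpos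
  have hξ0 : 0 < freqNorm ξ := hM0.trans hξ
  have hdecay := hC ((M : ℝ) ^ (-a)) ξ
  have hC0 : 0 ≤ C := hdecay.trans' (by positivity)
  have hfactor : freqNorm ξ ^ p =
      (|(M : ℝ) ^ (-a)| * freqNorm ξ) ^ K * ((M : ℝ) ^ (a * K) * freqNorm ξ ^ (p - K)) := by
    rw [abs_of_pos (by positivity), mul_pow, ← Real.rpow_mul_natCast hM0.le, ← Real.rpow_natCast,
      Real.rpow_sub hξ0, neg_mul, Real.rpow_neg hM0.le]
    field_simp
  calc ‖fourierTransform (mollifier d ((M : ℝ) ^ (-a))) ξ‖ * freqNorm ξ ^ p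
      ≤ C * ((M : ℝ) ^ (a * K) * freqNorm ξ ^ (p - K)) := by
        rw [hfactor, ← mul_assoc]
        gcongr
    _ ≤ C * ((M : ℝ) ^ (a * K) * (M : ℝ) ^ (p - K)) := by
        gcongr C * (_ * ?_)
        exact Real.rpow_le_rpow_of_nonpos hM0 hξ.le (by linarith)
    _ = C * (M : ℝ) ^ (-((1 - a) * K - p)) := by
        rw [← Real.rpow_add hM0]
        ring_nf
    _ ≤ ε := hM

theorem fourierSeminorm_mollifier_conv_lt_top (ρ : Measure (Torus d)) [IsFiniteMeasure ρ]
    {h : ℝ} (hh : h ≠ 0) (l : ℝ) : fourierSeminorm l (mollifier d h ∗ ρ) < ∞ := by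
  obtain ⟨K, hK⟩ := exists_nat_ge (l / 2)
  obtain ⟨C, hC⟩ := exists_norm_fourierTransform_mollifier_mul_le d K
  have hpow : 0 < |h| ^ K := pow_pos (abs_pos.2 hh) K
  refine weightedSup_lt_top_of_forall_ne_zero (C := C / |h| ^ K * ρ.real Set.univ) fun ξ hξ => ?_
  have hmol : ‖fourierTransform (mollifier d h) ξ‖ * freqNorm ξ ^ (l / 2) ≤ C / |h| ^ K := by
    have hfreq : freqNorm ξ ^ (l / 2) ≤ freqNorm ξ ^ K := by
      rw [← Real.rpow_natCast]
      exact Real.rpow_le_rpow_of_exponent_le (one_le_freqNorm hξ) hK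
    rw [le_div_iff₀ hpow]
    calc _ ≤ ‖fourierTransform (mollifier d h) ξ‖ * freqNorm ξ ^ K * |h| ^ K := by gcongr
      _ = ‖fourierTransform (mollifier d h) ξ‖ * (|h| * freqNorm ξ) ^ K := by ring
      _ ≤ C := hC h ξ
  calc ‖fourierTransform (mollifier d h ∗ ρ) ξ‖ * freqNorm ξ ^ (l / 2)
      = ‖fourierTransform (mollifier d h) ξ‖ * freqNorm ξ ^ (l / 2) * ‖fourierTransform ρ ξ‖ := by
        rw [fourierTransform_conv, norm_mul]
        ring
    _ ≤ C / |h| ^ K * ρ.real Set.univ := by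
        have hnonneg : 0 ≤ C / |h| ^ K :=
          hmol.trans' (mul_nonneg (norm_nonneg _) (Real.rpow_nonneg (freqNorm_nonneg ξ) _))
        gcongr
        exact norm_fourierTransform_le ρ ξ

theorem eventually_card_freqBall_mul_exp_lt (d : ℕ) {p c : ℝ} (hp : 0 < p) (hc : 0 < c) :
    ∀ᶠ M : ℕ in atTop,
      (freqBall d M).card * (4 * Real.exp (-(c * (M : ℝ) ^ p))) < 1 := by
  have hpow : Tendsto (fun M : ℕ => (M : ℝ) ^ p) atTop atTop :=
    (tendsto_rpow_atTop hp).comp tendsto_natCast_atTop_atTop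
  have hlim := ((tendsto_rpow_mul_exp_neg_mul_atTop_nhds_zero (d / p) c hc).comp
    hpow).const_mul ((3 : ℝ) ^ d * 4)
  rw [mul_zero] at hlim
  filter_upwards [hlim.eventually (gt_mem_nhds zero_lt_one), eventually_ge_atTop 1] with M hM hM1
  have hM1' : (1 : ℝ) ≤ M := by exact_mod_cast hM1
  have hcard : ((freqBall d M).card : ℝ) ≤ (3 * M) ^ d :=
    calc ((freqBall d M).card : ℝ) ≤ (2 * M + 1) ^ d := by exact_mod_cast card_freqBall_le d M
      _ ≤ (3 * M) ^ d := by gcongr; linarith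
  refine lt_of_le_of_lt ?_ hM
  rw [Function.comp_apply, ← Real.rpow_mul (by positivity), mul_div_cancel₀ _ hp.ne',
    Real.rpow_natCast]
  calc (freqBall d M).card * (4 * Real.exp (-(c * (M : ℝ) ^ p)))
      ≤ (3 * M : ℝ) ^ d * (4 * Real.exp (-(c * (M : ℝ) ^ p))) := by gcongr
    _ = _ := by rw [mul_pow, neg_mul]; ring

theorem eventually_exists_sample_norm_fourierTransform_sub_mul_le (μ : Measure (Torus d))
    [IsProbabilityMeasure μ] {E : Set (Torus d)} (hE : ∀ᵐ x ∂μ, x ∈ E) {l b ε : ℝ} (hl : 0 ≤ l)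
    (hlb : l < b) (hε : 0 < ε) :
    ∀ᶠ M : ℕ in atTop, ∃ X : Fin ⌈(M : ℝ) ^ b⌉₊ → Torus d, (∀ j, X j ∈ E) ∧
      ∀ ξ, freqNorm ξ ≤ M →
        ‖fourierTransform (empiricalMeasure X) ξ - fourierTransform μ ξ‖ *
          freqNorm ξ ^ (l / 2) ≤ ε := by
  filter_upwards [eventually_card_freqBall_mul_exp_lt d (sub_pos.2 hlb)
    (show 0 < ε ^ 2 / 8 by positivity), eventually_gt_atTop 0] with M hM hMpos
  have hM0 : (0 : ℝ) < M := Nat.cast_pos.2 hMpos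
  have : NeZero ⌈(M : ℝ) ^ b⌉₊ := ⟨(Nat.ceil_pos.2 (by positivity)).ne'⟩
  set s : ℝ := ε / 2 * (M : ℝ) ^ (-(l / 2)) with hs
  have hexp : ε ^ 2 / 8 * (M : ℝ) ^ (b - l) ≤ ⌈(M : ℝ) ^ b⌉₊ * s ^ 2 / 2 :=
    calc ε ^ 2 / 8 * (M : ℝ) ^ (b - l) = (M : ℝ) ^ b * s ^ 2 / 2 := by
          rw [hs, mul_pow, ← Real.rpow_mul_natCast hM0.le, Nat.cast_two, neg_mul,
            div_mul_cancel₀ l two_ne_zero, sub_eq_add_neg, Real.rpow_add hM0]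
          ring
      _ ≤ _ := by gcongr; exact Nat.le_ceil _
  obtain ⟨X, hXE, hX⟩ := exists_sample_norm_fourierTransform_sub_le (N := ⌈(M : ℝ) ^ b⌉₊) μ hE
    (freqBall d M) (s := s) (by positivity) (hM.trans_le' (by gcongr))
  refine ⟨X, hXE, fun ξ hξ => ?_⟩
  calc _ ≤ 2 * s * (M : ℝ) ^ (l / 2) := by
        have := freqNorm_nonneg ξ
        gcongr
        exact hX ξ (mem_freqBall.2 hξ)
    _ = ε := by
        rw [hs, Real.rpow_neg hM0.le]
        field_simp

theorem eventually_exists_fourierSeminormDiff_mollifier_conv_le (μ : Measure (Torus d))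
    [IsProbabilityMeasure μ] {E : Set (Torus d)} (hE : ∀ᵐ x ∂μ, x ∈ E) {a b l l' ε : ℝ}
    (ha0 : 0 < a) (ha1 : a < 1) (hl : 0 ≤ l) (hlb : l < b) (hll' : l < l')
    (hμ : fourierSeminorm l' μ < ∞) (hε : 0 < ε) :
    ∀ᶠ M : ℕ in atTop, ∃ X : Fin ⌈(M : ℝ) ^ b⌉₊ → Torus d, (∀ j, X j ∈ E) ∧
      fourierSeminormDiff l (mollifier d ((M : ℝ) ^ (-a)) ∗ empiricalMeasure X) μ ≤
        ENNReal.ofReal ε := by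
  let φ (M : ℕ) : Measure (Torus d) := mollifier d ((M : ℝ) ^ (-a))
  have hφ (M : ℕ) (ξ : Fin d → ℤ) : ‖fourierTransform (φ M) ξ‖ ≤ 1 :=
    (norm_fourierTransform_le _ ξ).trans_eq probReal_univ
  have hsmooth : ∀ᶠ M : ℕ in atTop,
      weightedSup l (fun ξ => (fourierTransform (φ M) ξ - 1) * fourierTransform μ ξ) ≤
        ENNReal.ofReal (ε / 2) := by
    refine eventually_weightedSup_mul_le hll' hμ (B := 2) (fun ξ => ?_) (fun M ξ => ?_)
      (half_pos hε)
    · simpa using ((tendsto_fourierTransform_mollifier ξ).comp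
        (tendsto_natCast_rpow_neg ha0)).sub_const 1
    · exact (norm_sub_le _ _).trans (by rw [norm_one]; linarith [hφ M ξ])
  filter_upwards [hsmooth, eventually_gt_atTop 0,
    eventually_exists_sample_norm_fourierTransform_sub_mul_le μ hE hl hlb (half_pos hε),
    eventually_norm_fourierTransform_mollifier_mul_le d ha1 (l / 2)
      (show 0 < ε / 4 by positivity)] with M hM hMpos ⟨X, hXE, hlow⟩ hhigh
  have : NeZero ⌈(M : ℝ) ^ b⌉₊ := ⟨(Nat.ceil_pos.2 (by positivity)).ne'⟩
  let D (ξ : Fin d → ℤ) : ℂ := fourierTransform (empiricalMeasure X) ξ - fourierTransform μ ξ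
  have hD (ξ : Fin d → ℤ) : ‖D ξ‖ ≤ 2 := by
    have hX1 := norm_fourierTransform_le (empiricalMeasure X) ξ
    have hμ1 := norm_fourierTransform_le μ ξ
    rw [probReal_univ] at hX1 hμ1
    exact (norm_sub_le _ _).trans (by linarith)
  have hdiscrete : weightedSup l (fun ξ => fourierTransform (φ M) ξ * D ξ) ≤
      ENNReal.ofReal (ε / 2) :=
    weightedSup_mul_le_ofReal_of_cutoff (hφ M) hD hlow fun ξ hξ => by linarith [hhigh ξ hξ]
  refine ⟨X, hXE, ?_⟩
  calc fourierSeminormDiff l (φ M ∗ empiricalMeasure X) μ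
      = weightedSup l ((fun ξ => fourierTransform (φ M) ξ * D ξ) +
          fun ξ => (fourierTransform (φ M) ξ - 1) * fourierTransform μ ξ) := by
        rw [fourierSeminormDiff]
        congr 1
        funext ξ
        simp only [fourierTransform_conv, Pi.add_apply, D]
        ring
    _ ≤ ENNReal.ofReal (ε / 2) + ENNReal.ofReal (ε / 2) :=
        weightedSup_add_le.trans (add_le_add hdiscrete hM)
    _ = ENNReal.ofReal ε := by rw [← ENNReal.ofReal_add (by positivity) (by positivity), add_halves]

end Approximation

section ThinCover

variable {X : Type*}

/-- `K` has a thin cover when finitely many balls of one radius `r < δ` cover it and their number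
times `r ^ t` is less than `δ`. Having thin covers for every `δ > 0` says that the `t`-dimensional
lower Minkowski content of `K` vanishes; for fixed `δ` it is an open condition on `K`. -/
def HasThinCover [PseudoMetricSpace X] (t δ : ℝ) (K : Set X) : Prop :=
  ∃ r ∈ Set.Ioo 0 δ, ∃ A : Finset X, A.card * r ^ t < δ ∧ K ⊆ Metric.thickening r A

theorem isOpen_hasThinCover [PseudoMetricSpace X] (t δ : ℝ) :
    IsOpen {K : Compacts X | HasThinCover t δ (K : Set X)} := by
  rw [isOpen_iff_mem_nhds]
  rintro K ⟨r, hr, A, hA, hK⟩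
  filter_upwards [(Compacts.isOpen_subsets_of_isOpen Metric.isOpen_thickening).mem_nhds hK]
    with L hL using ⟨r, hr, A, hA, hL⟩

theorem hausdorffMeasure_eq_zero_of_hasThinCover [MetricSpace X] [MeasurableSpace X]
    [BorelSpace X] {t : ℝ} (ht : 0 ≤ t) {K : Set X}
    (h : ∀ n : ℕ, HasThinCover t (1 / ((n : ℝ) + 1)) K) : μH[t] K = 0 := by
  choose r hr A hA hK using h
  have hdiam (n) (x : A n) :
      Metric.ediam (Metric.ball (x : X) (r n)) ≤ ENNReal.ofReal (2 * r n) := by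
    rw [← Metric.eball_ofReal, ENNReal.ofReal_mul two_pos.le, ENNReal.ofReal_ofNat]
    exact Metric.ediam_eball_le
  have hlim : Tendsto (fun n : ℕ => 1 / ((n : ℝ) + 1)) atTop (𝓝 0) :=
    tendsto_one_div_add_atTop_nhds_zero_nat
  have hrlim : Tendsto (fun n => ENNReal.ofReal (2 * r n)) atTop (𝓝 0) := by
    have : Tendsto r atTop (𝓝 0) := squeeze_zero (fun n => (hr n).1.le) (fun n => (hr n).2.le) hlim
    simpa using ENNReal.tendsto_ofReal (this.const_mul 2)
  have hsum (n) : ∑ x : A n, Metric.ediam (Metric.ball (x : X) (r n)) ^ t ≤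
      ENNReal.ofReal (2 ^ t * (1 / ((n : ℝ) + 1))) := by
    calc ∑ x : A n, Metric.ediam (Metric.ball (x : X) (r n)) ^ t
        ≤ ∑ _x : A n, ENNReal.ofReal (2 * r n) ^ t := by gcongr with x; exact hdiam n x
      _ = ENNReal.ofReal (2 ^ t * ((A n).card * r n ^ t)) := by
        have hr0 := (hr n).1.le
        rw [Finset.sum_const, Finset.card_univ, Fintype.card_coe, nsmul_eq_mul,
          ENNReal.ofReal_rpow_of_nonneg (by positivity) ht, ← ENNReal.ofReal_natCast,
          ← ENNReal.ofReal_mul (by positivity), Real.mul_rpow two_pos.le hr0, mul_left_comm]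
      _ ≤ _ := by gcongr; exact (hA n).le
  refine le_antisymm ?_ zero_le
  have hsumlim := ENNReal.tendsto_ofReal (hlim.const_mul ((2 : ℝ) ^ t))
  rw [mul_zero, ENNReal.ofReal_zero] at hsumlim
  calc μH[t] K
      ≤ liminf (fun n => ∑ x : A n, Metric.ediam (Metric.ball (x : X) (r n)) ^ t) atTop :=
        Measure.hausdorffMeasure_le_liminf_sum t K _ hrlim _ (Eventually.of_forall hdiam)
          (Eventually.of_forall fun n => by
            simpa [Metric.thickening_eq_biUnion_ball, Set.iUnion_subtype] using hK n)
    _ ≤ liminf (fun n : ℕ => ENNReal.ofReal (2 ^ t * (1 / ((n : ℝ) + 1)))) atTop :=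
        liminf_le_liminf (Eventually.of_forall hsum)
    _ = 0 := hsumlim.liminf_eq

theorem dimH_le_of_hasThinCover [MetricSpace X] {t : ℝ} (ht : 0 ≤ t) {K : Set X}
    (h : ∀ n : ℕ, HasThinCover t (1 / ((n : ℝ) + 1)) K) : dimH K ≤ ENNReal.ofReal t := by
  borelize X
  refine dimH_le_of_hausdorffMeasure_ne_top (d := t.toNNReal) ?_
  rw [Real.coe_toNNReal _ ht, hausdorffMeasure_eq_zero_of_hasThinCover ht h]
  exact ENNReal.zero_ne_top

theorem hausdorffEDist_cthickening_le [PseudoMetricSpace X] {A E : Set X} {h ε : ℝ} (hAE : A ⊆ E)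
    (hEA : E ⊆ Metric.cthickening ε A) (hhε : h ≤ ε) :
    Metric.hausdorffEDist (Metric.cthickening h A) E ≤ ENNReal.ofReal ε :=
  Metric.hausdorffEDist_le_of_infEDist
    (fun _ hx => (Metric.infEDist_anti hAE).trans
      (Metric.mem_cthickening_iff.1 (Metric.cthickening_mono hhε _ hx)))
    (fun _ hx => (Metric.infEDist_anti (Metric.self_subset_cthickening A)).trans
      (Metric.mem_cthickening_iff.1 (hEA hx)))

theorem exists_finset_subset_subset_cthickening [PseudoMetricSpace X] {E : Set X}
    (hE : IsCompact E) {ε : ℝ} (hε : 0 < ε) :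
    ∃ F : Finset X, (F : Set X) ⊆ E ∧ E ⊆ Metric.cthickening ε F := by
  obtain ⟨F, hFE, hF, hEF⟩ := finite_cover_balls_of_compact hE hε
  rw [← Metric.thickening_eq_biUnion_ball] at hEF
  exact ⟨hF.toFinset, by simpa using hFE,
    by simpa using hEF.trans (Metric.thickening_subset_cthickening _ _)⟩

theorem tendsto_natCast_add_ceil_mul_rpow {a b t : ℝ} (hb : 0 ≤ b) (hbt : b < a * t) (k : ℕ) :
    Tendsto (fun M : ℕ => ((k : ℝ) + ⌈(M : ℝ) ^ b⌉₊) * (2 * (M : ℝ) ^ (-a)) ^ t) atTop (𝓝 0) := by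
  have hlim := (tendsto_natCast_rpow_neg (sub_pos.2 hbt)).const_mul (((k : ℝ) + 2) * 2 ^ t)
  rw [mul_zero] at hlim
  refine squeeze_zero' (Eventually.of_forall fun M => by positivity) ?_ hlim
  filter_upwards [eventually_ge_atTop 1] with M hM
  have hM1 : (1 : ℝ) ≤ M := by exact_mod_cast hM
  have hMb : 1 ≤ (M : ℝ) ^ b := Real.one_le_rpow hM1 hb
  have hcount : (k : ℝ) + ⌈(M : ℝ) ^ b⌉₊ ≤ (k + 2) * (M : ℝ) ^ b := by
    nlinarith [(Nat.ceil_lt_add_one (zero_le_one.trans hMb)).le, k.cast_nonneg (α := ℝ)]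
  calc ((k : ℝ) + ⌈(M : ℝ) ^ b⌉₊) * (2 * (M : ℝ) ^ (-a)) ^ t
      ≤ (k + 2) * (M : ℝ) ^ b * (2 * (M : ℝ) ^ (-a)) ^ t := by gcongr
    _ = (k + 2) * 2 ^ t * (M : ℝ) ^ (-(a * t - b)) := by
      rw [Real.mul_rpow two_pos.le (by positivity), ← Real.rpow_mul (by positivity), neg_sub,
        sub_eq_add_neg, Real.rpow_add (by positivity), neg_mul]
      ring

end ThinCover

section Density

variable {d : ℕ} {β : ℝ}

theorem ae_mem_of_mem_XSpace {p : Compacts (Torus d) × MSpace d β} (hp : p ∈ XSpace d β) :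
    ∀ᵐ x ∂p.2.1, x ∈ (p.1 : Set (Torus d)) := by
  filter_upwards [Measure.support_mem_ae (μ := p.2.1)] with x hx using hp.2 hx

theorem fourierSeminormDiff_mono {l l' : ℝ} (hll' : l ≤ l') (μ ν : Measure (Torus d))
    [IsProbabilityMeasure μ] [IsProbabilityMeasure ν] :
    fourierSeminormDiff l μ ν ≤ fourierSeminormDiff l' μ ν :=
  weightedSup_mono hll' (by simp [fourierTransform_zero])

theorem XSpace.mem_closure_of_forall_exists (hβ : 0 < β) {S : Set (XSpace d β)} {p : XSpace d β}
    (h : ∀ l ∈ Set.Ico 0 β, ∀ ε > 0, ∃ q ∈ S, edist q.1.1 p.1.1 ≤ ENNReal.ofReal ε ∧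
      fourierSeminormDiff l q.1.2.1 p.1.2.1 ≤ ENNReal.ofReal ε) : p ∈ closure S := by
  obtain ⟨l, -, hl, hlβ⟩ := exists_seq_strictMono_tendsto' hβ
  choose q hqS hqE hqμ using fun n : ℕ =>
    h (l n) (Set.Ioo_subset_Ico_self (hl n)) (1 / ((n : ℝ) + 1)) (by positivity)
  have hlim : Tendsto (fun n : ℕ => ENNReal.ofReal (1 / ((n : ℝ) + 1))) atTop (𝓝 0) := by
    simpa using ENNReal.tendsto_ofReal (tendsto_one_div_add_atTop_nhds_zero_nat (𝕜 := ℝ))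
  refine mem_closure_of_tendsto (f := q) (b := atTop) ?_ (Eventually.of_forall hqS)
  rw [tendsto_subtype_rng, Prod.tendsto_iff]
  refine ⟨tendsto_iff_edist_tendsto_0.2 ?_, (MSpace.tendsto_iff _ _ _).2 fun l' _ hl'β => ?_⟩
  · exact tendsto_of_tendsto_of_tendsto_of_le_of_le tendsto_const_nhds hlim (fun _ => zero_le) hqE
  · refine tendsto_of_tendsto_of_tendsto_of_le_of_le' tendsto_const_nhds hlim
      (Eventually.of_forall fun _ => zero_le) ?_
    filter_upwards [hlβ.eventually (le_mem_nhds hl'β)] with n hn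
    have := (q n).2.1
    have := p.2.1
    exact (fourierSeminormDiff_mono hn _ _).trans (hqμ n)

/-- The convolution is carried by the `h`-neighbourhood of `A`, which is covered by `#A` balls of
radius `2h`. -/
theorem exists_XSpace_eq_mollifier_conv {h t δ ε : ℝ} (hh : 0 < h) (hhδ : 2 * h < δ) (hhε : h ≤ ε)
    {E : Compacts (Torus d)} {A : Finset (Torus d)} (hAE : (A : Set (Torus d)) ⊆ E)
    (hEA : (E : Set (Torus d)) ⊆ Metric.cthickening ε A) (hA : A.card * (2 * h) ^ t < δ)
    {ρ : Measure (Torus d)} [IsProbabilityMeasure ρ] (hρ : ∀ᵐ x ∂ρ, x ∈ (A : Set (Torus d))) :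
    ∃ q : XSpace d β, HasThinCover t δ (q.1.1 : Set (Torus d)) ∧
      edist q.1.1 E ≤ ENNReal.ofReal ε ∧ q.1.2.1 = mollifier d h ∗ ρ := by
  have hcompact : IsCompact (Metric.cthickening h (A : Set (Torus d))) :=
    Metric.isClosed_cthickening.isCompact
  have hmem : ∀ᵐ x ∂(mollifier d h ∗ ρ), x ∈ Metric.cthickening h (A : Set (Torus d)) :=
    ae_conv_of_forall_add_mem (A := {x | ‖x‖ ≤ h}) (ae_norm_le_mollifier d hh.le) hρ
      hcompact.isClosed.measurableSet fun x hx y hy =>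
        Metric.mem_cthickening_of_dist_le _ y _ _ hy (by simpa using hx)
  refine ⟨⟨(⟨_, hcompact⟩, ⟨mollifier d h ∗ ρ, inferInstance, fun l _ _ =>
    fourierSeminorm_mollifier_conv_lt_top ρ hh.ne' l⟩), (inferInstance :
      IsProbabilityMeasure (mollifier d h ∗ ρ)),
    Measure.support_subset_of_isClosed hcompact.isClosed hmem⟩, ?_, ?_, rfl⟩
  · exact ⟨2 * h, ⟨by positivity, hhδ⟩, A, hA,
      Metric.cthickening_subset_thickening' (by positivity) (by linarith) _⟩
  · rw [Compacts.edist_eq]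
    exact hausdorffEDist_cthickening_le hAE hEA hhε

theorem exists_hasThinCover_fourierSeminormDiff_le {l t δ ε : ℝ} (hl : l ∈ Set.Ico 0 β)
    (hβt : β < t) (hδ : 0 < δ) (hε : 0 < ε) (p : XSpace d β) :
    ∃ q : XSpace d β, HasThinCover t δ (q.1.1 : Set (Torus d)) ∧
      edist q.1.1 p.1.1 ≤ ENNReal.ofReal ε ∧
      fourierSeminormDiff l q.1.2.1 p.1.2.1 ≤ ENNReal.ofReal ε := by
  classical
  obtain ⟨⟨E, μ, -, hμ⟩, hp⟩ := p
  have : IsProbabilityMeasure μ := hp.1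
  obtain ⟨b, hlb, hbβ⟩ := exists_between hl.2
  have hb : 0 < b := hl.1.trans_lt hlb
  have ht : 0 < t := hb.trans (hbβ.trans hβt)
  obtain ⟨a, hba, ha⟩ := exists_between ((div_lt_one ht).2 (hbβ.trans hβt))
  have ha0 : 0 < a := (div_pos hb ht).trans hba
  obtain ⟨F, hFE, hEF⟩ := exists_finset_subset_subset_cthickening E.isCompact hε
  have hh := tendsto_natCast_rpow_neg ha0
  have hcount := tendsto_natCast_add_ceil_mul_rpow hb.le ((div_lt_iff₀ ht).1 hba) F.card
  obtain ⟨M, hM, hMδ, hMε, hMcard, X, hXE, hX⟩ := ((eventually_gt_atTop 0).and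
    (((hh.const_mul 2).eventually_lt_const (by simpa using hδ)).and
      ((hh.eventually_le_const hε).and ((hcount.eventually_lt_const hδ).and
        (eventually_exists_fourierSeminormDiff_mollifier_conv_le μ (ae_mem_of_mem_XSpace hp)
          ha0 ha hl.1 hlb hlb (hμ b hb.le hbβ) hε))))).exists
  have hM0 : (0 : ℝ) < M := by exact_mod_cast hM
  have : NeZero ⌈(M : ℝ) ^ b⌉₊ := ⟨(Nat.ceil_pos.2 (by positivity)).ne'⟩
  have hA : (↑(F ∪ Finset.univ.image X) : Set (Torus d)) = ↑F ∪ Set.range X := by simp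
  have hAcard : ((F ∪ Finset.univ.image X).card : ℝ) ≤ F.card + ⌈(M : ℝ) ^ b⌉₊ := by
    exact_mod_cast (Finset.card_union_le _ _).trans
      (Nat.add_le_add_left (Finset.card_image_le.trans_eq (Finset.card_fin _)) _)
  obtain ⟨q, hq, hqE, hqμ⟩ := exists_XSpace_eq_mollifier_conv (β := β)
    (A := F ∪ Finset.univ.image X) (Real.rpow_pos_of_pos hM0 (-a)) hMδ hMε
    (hA ▸ Set.union_subset hFE (Set.range_subset_iff.2 hXE))
    (hEF.trans (Metric.cthickening_subset_of_subset _ (hA ▸ Set.subset_union_left)))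
    (lt_of_le_of_lt (by gcongr) hMcard)
    ((ae_empiricalMeasure_mem_range X).mono fun x hx => hA ▸ Or.inr hx)
  exact ⟨q, hq, hqE, hqμ ▸ hX⟩

theorem dense_hasThinCover (hβ : 0 < β) {t δ : ℝ} (hβt : β < t) (hδ : 0 < δ) :
    Dense {p : XSpace d β | HasThinCover t δ (p.1.1 : Set (Torus d))} := fun p =>
  XSpace.mem_closure_of_forall_exists hβ fun _ hl _ hε =>
    exists_hasThinCover_fourierSeminormDiff_le hl hβt hδ hε p

theorem eventually_residual_dimH_le (hβ : 0 < β) :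
    ∀ᶠ p : XSpace d β in residual (XSpace d β),
      dimH (p.1.1 : Set (Torus d)) ≤ ENNReal.ofReal β := by
  have hcover : ∀ᶠ p : XSpace d β in residual (XSpace d β), ∀ m n : ℕ,
      HasThinCover (β + 1 / ((m : ℝ) + 1)) (1 / ((n : ℝ) + 1)) (p.1.1 : Set (Torus d)) := by
    simp only [eventually_countable_forall]
    exact fun m n => residual_of_dense_open
      ((isOpen_hasThinCover _ _).preimage (continuous_fst.comp continuous_subtype_val))
      (dense_hasThinCover hβ (lt_add_of_pos_right β (by positivity)) (by positivity))
  filter_upwards [hcover] with p hp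
  have hlim : Tendsto (fun m : ℕ => ENNReal.ofReal (β + 1 / ((m : ℝ) + 1))) atTop
      (𝓝 (ENNReal.ofReal β)) := by
    simpa using ENNReal.tendsto_ofReal
      ((tendsto_one_div_add_atTop_nhds_zero_nat (𝕜 := ℝ)).const_add β)
  exact ge_of_tendsto' hlim fun m => dimH_le_of_hasThinCover (by positivity) (hp m)

end Density

section RieszPotential

variable {X : Type*} [EMetricSpace X] [MeasurableSpace X] [BorelSpace X] {μ : Measure X} {t : ℝ}

/-- The Riesz potential `x ↦ ∫ d(x, y)^(-t) dμ(y)`, whose `μ`-integral is the `t`-energy of `μ`. -/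
def rieszPotential (t : ℝ) (μ : Measure X) (x : X) : ℝ≥0∞ :=
  ∫⁻ y, edist x y ^ (-t) ∂μ

theorem measurable_rieszPotential [SecondCountableTopology X] [SFinite μ] :
    Measurable (rieszPotential t μ) :=
  Measurable.lintegral_prod_right' (f := fun p : X × X => edist p.1 p.2 ^ (-t))
    (measurable_edist.pow_const _)

theorem measure_mul_ediam_rpow_neg_le_rieszPotential {U : Set X} (ht : 0 ≤ t) {x : X}
    (hx : x ∈ U) : μ U * Metric.ediam U ^ (-t) ≤ rieszPotential t μ x := by
  have hsub : U ⊆ {y | Metric.ediam U ^ (-t) ≤ edist x y ^ (-t)} := fun y hy => by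
    simp only [Set.mem_ofPred_eq, ENNReal.rpow_neg]
    gcongr
    exact Metric.edist_le_ediam_of_mem hx hy
  rw [mul_comm]
  calc Metric.ediam U ^ (-t) * μ U
      ≤ Metric.ediam U ^ (-t) * μ {y | Metric.ediam U ^ (-t) ≤ edist x y ^ (-t)} := by gcongr
    _ ≤ rieszPotential t μ x :=
        mul_meas_ge_le_lintegral (measurable_edist_right.pow_const _) _

theorem withDensity_inv_rieszPotential_le_hausdorffMeasure [IsFiniteMeasure μ] (ht : 0 ≤ t) :
    μ.withDensity (fun x => (rieszPotential t μ x)⁻¹) ≤ μH[t] := by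
  refine Measure.le_hausdorffMeasure t _ 1 one_pos fun U _ => ?_
  have hmeas : MeasurableSet (closure U) := isClosed_closure.measurableSet
  rw [← Metric.ediam_closure U]
  refine (measure_mono subset_closure).trans ?_
  rw [withDensity_apply _ hmeas]
  rcases eq_or_ne (μ (closure U)) 0 with hU | hU
  · simp [Measure.restrict_eq_zero.2 hU]
  calc ∫⁻ x in closure U, (rieszPotential t μ x)⁻¹ ∂μ
      ≤ ∫⁻ _ in closure U, (μ (closure U) * Metric.ediam (closure U) ^ (-t))⁻¹ ∂μ :=
        setLIntegral_mono' hmeas fun x hx => ENNReal.inv_le_inv.2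
          (measure_mul_ediam_rpow_neg_le_rieszPotential ht hx)
    _ = μ (closure U) * (μ (closure U))⁻¹ * Metric.ediam (closure U) ^ t := by
        rw [setLIntegral_const, ENNReal.mul_inv (.inl hU) (.inl (measure_ne_top _ _)),
          ENNReal.rpow_neg, inv_inv]
        ring
    _ = Metric.ediam (closure U) ^ t := by
        rw [ENNReal.mul_inv_cancel hU (measure_ne_top _ _), one_mul]

theorem coe_le_dimH_of_lintegral_rieszPotential_ne_top [SecondCountableTopology X]
    [IsFiniteMeasure μ] {t : ℝ≥0} (h : ∫⁻ x, rieszPotential t μ x ∂μ ≠ ∞) {E : Set X}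
    (hE : μ E ≠ 0) : (t : ℝ≥0∞) ≤ dimH E := by
  have hac : μ ≪ μ.withDensity fun x => (rieszPotential t μ x)⁻¹ :=
    withDensity_absolutelyContinuous' measurable_rieszPotential.inv.aemeasurable <| by
      filter_upwards [ae_lt_top measurable_rieszPotential h] with x hx
        using ENNReal.inv_ne_zero.2 hx.ne
  refine le_dimH_of_hausdorffMeasure_ne_zero fun hzero => hE (hac ?_)
  exact le_antisymm
    ((withDensity_inv_rieszPotential_le_hausdorffMeasure t.2 E).trans_eq hzero) zero_le

end RieszPotential

section CorrelationIntegral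

theorem lintegral_rpow_lt_top_of_measure_le_rpow {α : Type*} [MeasurableSpace α] {m : Measure α}
    [IsFiniteMeasure m] {f : α → ℝ} (hf : 0 ≤ᵐ[m] f) (hfm : AEMeasurable f m) {p q C : ℝ}
    (hp : 0 < p) (hpq : p < q)
    (h : ∀ s : ℝ, 1 < s → m {x | s ≤ f x} ≤ ENNReal.ofReal (C * s ^ (-q))) :
    ∫⁻ x, ENNReal.ofReal (f x ^ p) ∂m < ∞ := by
  rw [lintegral_rpow_eq_lintegral_meas_le_mul m hf hfm hp, ← Set.Ioc_union_Ioi_eq_Ioi zero_le_one,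
    lintegral_union measurableSet_Ioi (Set.Ioc_disjoint_Ioi le_rfl)]
  refine ENNReal.mul_lt_top ENNReal.ofReal_lt_top (ENNReal.add_lt_top.2 ⟨?_, ?_⟩)
  · have hint : IntegrableOn (fun s : ℝ => s ^ (p - 1)) (Set.Ioc 0 1) :=
      (intervalIntegrable_iff_integrableOn_Ioc_of_le zero_le_one).1
        (intervalIntegral.intervalIntegrable_rpow' (by linarith))
    calc ∫⁻ s in Set.Ioc 0 1, m {x | s ≤ f x} * ENNReal.ofReal (s ^ (p - 1))
        ≤ ∫⁻ s in Set.Ioc (0 : ℝ) 1, m Set.univ * ENNReal.ofReal (s ^ (p - 1)) := by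
          gcongr
          exact Set.subset_univ _
      _ = m Set.univ * ∫⁻ s in Set.Ioc (0 : ℝ) 1, ENNReal.ofReal (s ^ (p - 1)) :=
          lintegral_const_mul' _ _ (measure_ne_top _ _)
      _ < ∞ := ENNReal.mul_lt_top (measure_lt_top _ _) hint.lintegral_lt_top
  · have hint : IntegrableOn (fun s : ℝ => C * s ^ (-q + (p - 1))) (Set.Ioi 1) :=
      (integrableOn_Ioi_rpow_of_lt (by linarith) one_pos).const_mul C
    refine lt_of_le_of_lt (setLIntegral_mono' measurableSet_Ioi fun s hs => ?_)
      hint.lintegral_lt_top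
    have hs0 : 0 < s := one_pos.trans hs
    calc m {x | s ≤ f x} * ENNReal.ofReal (s ^ (p - 1))
        ≤ ENNReal.ofReal (C * s ^ (-q)) * ENNReal.ofReal (s ^ (p - 1)) := by
          gcongr
          exact h s hs
      _ = ENNReal.ofReal (C * s ^ (-q + (p - 1))) := by
          rw [← ENNReal.ofReal_mul' (by positivity), mul_assoc, ← Real.rpow_add hs0]

theorem lintegral_rieszPotential_lt_top_of_measure_dist_le {X : Type*} [MetricSpace X]
    [SecondCountableTopology X] [MeasurableSpace X] [BorelSpace X] {μ : Measure X}
    [IsFiniteMeasure μ] {t q C : ℝ} (ht : 0 < t) (htq : t < q)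
    (h : ∀ r : ℝ, 0 < r →
      (μ.prod μ) {p | dist p.1 p.2 ≤ r} ≤ ENNReal.ofReal (C * r ^ q)) :
    ∫⁻ x, rieszPotential t μ x ∂μ < ∞ := by
  -- On the diagonal the kernel is infinite, whereas the real number `(dist p.1 p.2)⁻¹` is `0`.
  have hdiag : ∀ᵐ p ∂μ.prod μ, 0 < dist p.1 p.2 := by
    have hlim : Tendsto (fun r : ℝ => ENNReal.ofReal (C * r ^ q)) (𝓝[>] 0) (𝓝 0) := by
      have hpow : Tendsto (fun r : ℝ => C * r ^ q) (𝓝 0) (𝓝 (C * 0 ^ q)) :=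
        (Real.continuousAt_rpow_const 0 q (.inr (ht.trans htq).le)).tendsto.const_mul C
      rw [Real.zero_rpow (ht.trans htq).ne', mul_zero] at hpow
      simpa using ENNReal.tendsto_ofReal (hpow.mono_left nhdsWithin_le_nhds)
    refine ae_iff.2 (le_antisymm (ge_of_tendsto hlim ?_) zero_le)
    filter_upwards [self_mem_nhdsWithin] with r hr
    exact (measure_mono fun p hp => (not_lt.1 hp).trans (le_of_lt hr)).trans (h r hr)
  have hlt := lintegral_rpow_lt_top_of_measure_le_rpow (m := μ.prod μ)
    (f := fun p => (dist p.1 p.2)⁻¹) (C := C) (ae_of_all _ fun p => by positivity)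
    measurable_dist.inv.aemeasurable ht htq fun s hs => ?_
  · rw [show ∫⁻ x, rieszPotential t μ x ∂μ = ∫⁻ p, edist p.1 p.2 ^ (-t) ∂μ.prod μ from
      (lintegral_prod _ (measurable_edist.pow_const _).aemeasurable).symm]
    refine (lintegral_congr_ae ?_).trans_lt hlt
    filter_upwards [hdiag] with p hp
    rw [edist_dist, ENNReal.ofReal_rpow_of_pos hp, Real.inv_rpow dist_nonneg, Real.rpow_neg hp.le]
  · have hs0 : 0 < s := one_pos.trans hs
    refine (measure_mono fun p hp => ?_).trans ((h s⁻¹ (inv_pos.2 hs0)).trans_eq ?_)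
    · have hsp : s ≤ (dist p.1 p.2)⁻¹ := hp
      exact le_inv_of_le_inv₀ hs0 hsp
    · rw [Real.inv_rpow hs0.le, Real.rpow_neg hs0.le]

end CorrelationIntegral

section DirichletKernel

variable {d : ℕ}

theorem exists_coe_abs_eq_norm (x : UnitAddCircle) :
    ∃ y : ℝ, (y : UnitAddCircle) = x ∧ |y| = ‖x‖ := by
  induction x using QuotientAddGroup.induction_on with
  | H z =>
    refine ⟨z - round z, ?_, (UnitAddCircle.norm_eq (x := z)).symm⟩
    rw [AddCircle.coe_sub]
    simp

theorem fourier_coe_re (j : ℤ) (y : ℝ) :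
    (fourier j (y : UnitAddCircle)).re = Real.cos (2 * Real.pi * j * y) := by
  rw [fourier_coe_apply, ← Complex.exp_ofReal_mul_I_re]
  congr 2
  push_cast
  ring

theorem half_le_norm_sum_fourier {N : ℕ} {x : UnitAddCircle} (hx : ‖x‖ ≤ 1 / (6 * N)) :
    (N / 2 : ℝ) ≤ ‖∑ j ∈ Finset.Ico (0 : ℤ) N, fourier j x‖ := by
  obtain ⟨y, rfl, hy⟩ := exists_coe_abs_eq_norm x
  rw [← hy] at hx
  have hcos : ∀ j ∈ Finset.Ico (0 : ℤ) N, 1 / 2 ≤ (fourier j (y : UnitAddCircle)).re := by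
    intro j hj
    rw [Finset.mem_Ico] at hj
    have hj0 : (0 : ℝ) ≤ j := by exact_mod_cast hj.1
    have hjN : (j : ℝ) ≤ N := by exact_mod_cast hj.2.le
    have hN : (0 : ℝ) < N := by exact_mod_cast hj.1.trans_lt hj.2
    rw [fourier_coe_re, ← Real.cos_abs, ← Real.cos_pi_div_three]
    refine Real.cos_le_cos_of_nonneg_of_le_pi (abs_nonneg _) (by linarith [Real.pi_pos]) ?_
    calc |2 * Real.pi * j * y| = 2 * Real.pi * j * |y| := by
          rw [abs_mul, abs_of_nonneg (by positivity)]
      _ ≤ 2 * Real.pi * N * (1 / (6 * N)) := by gcongr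
      _ = Real.pi / 3 := by field_simp; norm_num
  calc (N / 2 : ℝ) = (Finset.Ico (0 : ℤ) N).card • (1 / 2 : ℝ) := by simp; ring
    _ ≤ ∑ j ∈ Finset.Ico (0 : ℤ) N, (fourier j (y : UnitAddCircle)).re :=
        Finset.card_nsmul_le_sum _ _ _ hcos
    _ ≤ _ := by
        rw [← Complex.re_sum]
        exact Complex.re_le_norm _

/-- The box of frequencies `{0, …, N-1}^d`. -/
def freqBox (d N : ℕ) : Finset (Fin d → ℤ) :=
  Fintype.piFinset fun _ => Finset.Ico (0 : ℤ) N

theorem card_freqBox (d N : ℕ) : (freqBox d N).card = N ^ d := by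
  simp [freqBox]

theorem norm_sub_le_of_mem_freqBox {N : ℕ} {j k : Fin d → ℤ} (hj : j ∈ freqBox d N)
    (hk : k ∈ freqBox d N) : ‖j - k‖ ≤ N := by
  refine (pi_norm_le_iff_of_nonneg N.cast_nonneg).2 fun i => ?_
  have hji := Finset.mem_Ico.1 (Fintype.mem_piFinset.1 hj i)
  have hki := Finset.mem_Ico.1 (Fintype.mem_piFinset.1 hk i)
  have habs : |j i - k i| ≤ N := abs_le.2 ⟨by linarith, by linarith⟩
  rw [Pi.sub_apply, Int.norm_eq_abs]
  exact_mod_cast habs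

/-- The Dirichlet kernel `∑ e^{2πi j·x}` on `𝕋^d`, over the frequencies `j ∈ freqBox d N`. -/
def dirichletKernel (d N : ℕ) (x : Torus d) : ℂ :=
  ∑ j ∈ freqBox d N, UnitAddTorus.mFourier j x

theorem continuous_dirichletKernel (d N : ℕ) : Continuous (dirichletKernel d N) :=
  continuous_finsetSum _ fun j _ => (UnitAddTorus.mFourier j).continuous

theorem half_pow_le_norm_dirichletKernel {N : ℕ} {x : Torus d} (hx : ‖x‖ ≤ 1 / (6 * N)) :
    (N / 2 : ℝ) ^ d ≤ ‖dirichletKernel d N x‖ := by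
  have hprod : dirichletKernel d N x = ∏ i, ∑ j ∈ Finset.Ico (0 : ℤ) N, fourier j (x i) :=
    Finset.sum_prod_piFinset (Finset.Ico (0 : ℤ) N) fun i j => fourier j (x i)
  rw [hprod, norm_prod]
  calc (N / 2 : ℝ) ^ d = ∏ _i : Fin d, (N / 2 : ℝ) := by
        rw [Finset.prod_const, Finset.card_univ, Fintype.card_fin]
    _ ≤ _ := Finset.prod_le_prod (fun _ _ => by positivity) fun i _ =>
      half_le_norm_sum_fourier ((norm_le_pi_norm x i).trans hx)

theorem mFourier_apply_neg (ξ : Fin d → ℤ) (x : Torus d) :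
    UnitAddTorus.mFourier ξ (-x) = UnitAddTorus.mFourier (-ξ) x := by
  simp [UnitAddTorus.mFourier, fourier_apply]

theorem ofReal_norm_dirichletKernel_sq (N : ℕ) (x : Torus d) :
    ((‖dirichletKernel d N x‖ ^ 2 : ℝ) : ℂ) =
      ∑ j ∈ freqBox d N, ∑ k ∈ freqBox d N, UnitAddTorus.mFourier (j - k) x := by
  rw [Complex.ofReal_pow, ← Complex.mul_conj', dirichletKernel, map_sum, Finset.sum_mul_sum]
  simp only [← UnitAddTorus.mFourier_neg, ← UnitAddTorus.mFourier_add, sub_eq_add_neg]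

end DirichletKernel

section FrequencySums

variable {d : ℕ}

theorem summable_max_one_norm_rpow {p : ℝ} (hp : (d : ℝ) < p) :
    Summable fun ξ : Fin d → ℤ => max 1 ‖ξ‖ ^ (-p) := by
  let L := Submodule.span ℤ (Set.range (Pi.basisFun ℝ (Fin d)))
  let e : (Fin d → ℤ) → L := fun ξ => ⟨fun i => ξ i, by
    simp [L, (Pi.basisFun ℝ (Fin d)).mem_span_iff_repr_mem ℤ]⟩
  have he : Function.Injective e := fun ξ η h => funext fun i => by
    simpa [e] using congrFun (congrArg Subtype.val h) i
  have hnorm (ξ : Fin d → ℤ) : ‖e ξ‖ = ‖ξ‖ := by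
    have hcoord : (Finset.univ.sup fun i => ‖(ξ i : ℝ)‖₊) = Finset.univ.sup fun i => ‖ξ i‖₊ :=
      Finset.sup_congr rfl fun i _ => NNReal.eq (Int.norm_cast_real (ξ i))
    simp [e, Pi.norm_def, hcoord]
  have hrank : Module.finrank ℤ L = d := by simp [ZLattice.rank ℝ L]
  have hsum := (ZLattice.summable_norm_rpow L (-p) (by rw [hrank]; linarith)).comp_injective he
  refine (hsum.add (hasSum_ite_eq (0 : Fin d → ℤ) (1 : ℝ)).summable).of_nonneg_of_le
    (fun ξ => by positivity) fun ξ => ?_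
  simp only [Function.comp_apply, hnorm]
  rcases eq_or_ne ξ 0 with rfl | hξ
  · simp [Real.rpow_nonneg]
  · have hone : 1 ≤ ‖ξ‖ := by
      obtain ⟨i, hi⟩ := Function.ne_iff.1 hξ
      refine le_trans ?_ (norm_le_pi_norm ξ i)
      rw [Int.norm_eq_abs]
      exact_mod_cast Int.one_le_abs hi
    simp [max_eq_right hone, hξ]

theorem sum_max_one_norm_sub_rpow_le_tsum {p : ℝ} (hp : (d : ℝ) < p) (S : Finset (Fin d → ℤ))
    (j : Fin d → ℤ) :
    ∑ k ∈ S, max 1 ‖j - k‖ ^ (-p) ≤ ∑' ξ : Fin d → ℤ, max 1 ‖ξ‖ ^ (-p) := by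
  rw [← (Equiv.subLeft j).tsum_eq fun ξ : Fin d → ℤ => max 1 ‖ξ‖ ^ (-p)]
  exact ((Equiv.subLeft j).summable_iff.2 (summable_max_one_norm_rpow hp)).sum_le_tsum _
    fun _ _ => by positivity

theorem exists_sum_freqBox_rpow_le {s t : ℝ} (htd : t ≤ d) (hts : t < s) :
    ∃ A, 0 ≤ A ∧ ∀ N : ℕ, 0 < N →
      ∑ j ∈ freqBox d N, ∑ k ∈ freqBox d N, max 1 ‖j - k‖ ^ (-s) ≤
        A * (N : ℝ) ^ (2 * d - t) := by
  set A := ∑' ξ : Fin d → ℤ, max 1 ‖ξ‖ ^ (-(d + (s - t)))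
  refine ⟨A, tsum_nonneg fun _ => by positivity, fun N hN => ?_⟩
  have hN0 : (0 : ℝ) < N := by exact_mod_cast hN
  have hterm : ∀ j ∈ freqBox d N, ∀ k ∈ freqBox d N,
      max 1 ‖j - k‖ ^ (-s) ≤ (N : ℝ) ^ (d - t) * max 1 ‖j - k‖ ^ (-(d + (s - t))) := by
    intro j hj k hk
    have hnorm : max 1 ‖j - k‖ ≤ N :=
      max_le (by exact_mod_cast hN) (norm_sub_le_of_mem_freqBox hj hk)
    have hpos : 0 < max 1 ‖j - k‖ := by positivity
    calc max 1 ‖j - k‖ ^ (-s)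
        = max 1 ‖j - k‖ ^ (d - t) * max 1 ‖j - k‖ ^ (-(d + (s - t))) := by
          rw [← Real.rpow_add hpos]
          congr 1
          ring
      _ ≤ _ := by gcongr
  have hrow : ∀ j ∈ freqBox d N, ∑ k ∈ freqBox d N, max 1 ‖j - k‖ ^ (-s) ≤
      (N : ℝ) ^ (d - t) * A := by
    intro j hj
    refine (Finset.sum_le_sum (hterm j hj)).trans ?_
    rw [← Finset.mul_sum]
    gcongr
    exact sum_max_one_norm_sub_rpow_le_tsum (by linarith) _ j
  calc ∑ j ∈ freqBox d N, ∑ k ∈ freqBox d N, max 1 ‖j - k‖ ^ (-s)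
      ≤ (freqBox d N).card • ((N : ℝ) ^ (d - t) * A) :=
        Finset.sum_le_card_nsmul _ _ _ hrow
    _ = A * ((N : ℝ) ^ (d : ℝ) * (N : ℝ) ^ (d - t)) := by
        rw [card_freqBox, nsmul_eq_mul, Nat.cast_pow, Real.rpow_natCast]
        ring
    _ = A * (N : ℝ) ^ (2 * d - t) := by
        rw [← Real.rpow_add hN0]
        congr 2
        ring

theorem exists_norm_sq_le_of_weightedSup_lt_top {f : (Fin d → ℤ) → ℂ} {s : ℝ} (hs : 0 ≤ s)
    (h : weightedSup s f < ∞) : ∃ C, 0 ≤ C ∧ ∀ ξ, ‖f ξ‖ ^ 2 ≤ C * max 1 ‖ξ‖ ^ (-s) := by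
  refine ⟨‖f 0‖ ^ 2 + (weightedSup s f).toReal ^ 2, by positivity, fun ξ => ?_⟩
  rcases eq_or_ne ξ 0 with rfl | hξ
  · simp
  have hone := one_le_freqNorm hξ
  have hmax : max 1 ‖ξ‖ ≤ freqNorm ξ := max_le hone (norm_le_freqNorm ξ)
  rw [Real.rpow_neg (by positivity), ← div_eq_mul_inv, le_div_iff₀ (by positivity)]
  calc ‖f ξ‖ ^ 2 * max 1 ‖ξ‖ ^ s ≤ ‖f ξ‖ ^ 2 * freqNorm ξ ^ s := by gcongr
    _ = (‖f ξ‖ * freqNorm ξ ^ (s / 2)) ^ 2 := by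
        rw [mul_pow, ← Real.rpow_mul_natCast (freqNorm_nonneg ξ)]
        congr 2
        push_cast
        ring
    _ ≤ (weightedSup s f).toReal ^ 2 := by
        have := freqNorm_nonneg ξ
        gcongr
        exact norm_mul_rpow_le_toReal_weightedSup h ξ
    _ ≤ ‖f 0‖ ^ 2 + (weightedSup s f).toReal ^ 2 := le_add_of_nonneg_left (sq_nonneg _)

end FrequencySums

section CorrelationDecay

variable {d : ℕ} (μ : Measure (Torus d)) [IsFiniteMeasure μ]

theorem integral_mFourier_sub (ξ : Fin d → ℤ) :
    ∫ p, UnitAddTorus.mFourier ξ (p.1 - p.2) ∂μ.prod μ = (‖fourierTransform μ ξ‖ ^ 2 : ℝ) := by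
  have hconj : ∫ x, UnitAddTorus.mFourier ξ x ∂μ = starRingEnd ℂ (fourierTransform μ ξ) := by
    rw [fourierTransform, ← integral_conj]
    simp only [← UnitAddTorus.mFourier_neg, neg_neg]
  simp only [sub_eq_add_neg, mFourier_apply_add, mFourier_apply_neg]
  rw [integral_prod_mul, hconj, Complex.ofReal_pow, ← Complex.conj_mul']
  rfl

theorem integral_norm_dirichletKernel_sub_sq (N : ℕ) :
    ∫ p, ‖dirichletKernel d N (p.1 - p.2)‖ ^ 2 ∂μ.prod μ =
      ∑ j ∈ freqBox d N, ∑ k ∈ freqBox d N, ‖fourierTransform μ (j - k)‖ ^ 2 := by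
  have hint (ξ : Fin d → ℤ) :
      Integrable (fun p : Torus d × Torus d => UnitAddTorus.mFourier ξ (p.1 - p.2)) (μ.prod μ) :=
    .of_bound ((UnitAddTorus.mFourier ξ).continuous.comp
      (continuous_fst.sub continuous_snd)).aestronglyMeasurable 1
      (ae_of_all _ fun _ => norm_mFourier_apply_le ξ _)
  rw [← Complex.ofReal_inj, ← integral_complex_ofReal]
  simp only [ofReal_norm_dirichletKernel_sq]
  rw [integral_finsetSum _ fun j _ => integrable_finsetSum _ fun k _ => hint (j - k)]
  simp only [integral_finsetSum _ fun k _ => hint (_ - k), integral_mFourier_sub,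
    Complex.ofReal_sum]

variable {μ}

theorem exists_integral_norm_dirichletKernel_sub_sq_le {s t : ℝ} (hs : 0 ≤ s) (htd : t ≤ d)
    (hts : t < s) (h : fourierSeminorm s μ < ∞) :
    ∃ C, 0 ≤ C ∧ ∀ N : ℕ, 0 < N →
      ∫ p, ‖dirichletKernel d N (p.1 - p.2)‖ ^ 2 ∂μ.prod μ ≤ C * (N : ℝ) ^ (2 * d - t) := by
  obtain ⟨B, hB, hdecay⟩ := exists_norm_sq_le_of_weightedSup_lt_top hs h
  obtain ⟨A, hA, hsum⟩ := exists_sum_freqBox_rpow_le htd hts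
  refine ⟨B * A, by positivity, fun N hN => ?_⟩
  calc ∫ p, ‖dirichletKernel d N (p.1 - p.2)‖ ^ 2 ∂μ.prod μ
      = ∑ j ∈ freqBox d N, ∑ k ∈ freqBox d N, ‖fourierTransform μ (j - k)‖ ^ 2 :=
        integral_norm_dirichletKernel_sub_sq μ N
    _ ≤ ∑ j ∈ freqBox d N, ∑ k ∈ freqBox d N, B * max 1 ‖j - k‖ ^ (-s) := by
        gcongr with j _ k _
        exact hdecay (j - k)
    _ ≤ B * (A * (N : ℝ) ^ (2 * d - t)) := by
        simp only [← Finset.mul_sum]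
        gcongr
        exact hsum N hN
    _ = B * A * (N : ℝ) ^ (2 * d - t) := by ring

theorem pow_mul_measureReal_prod_dist_le_integral (N : ℕ) :
    ((N / 2 : ℝ) ^ d) ^ 2 * (μ.prod μ).real {p | dist p.1 p.2 ≤ 1 / (6 * N)} ≤
      ∫ p, ‖dirichletKernel d N (p.1 - p.2)‖ ^ 2 ∂μ.prod μ := by
  have hcont : Continuous fun p : Torus d × Torus d => ‖dirichletKernel d N (p.1 - p.2)‖ ^ 2 :=
    ((continuous_dirichletKernel d N).comp (continuous_fst.sub continuous_snd)).norm.pow 2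
  have hsub : {p : Torus d × Torus d | dist p.1 p.2 ≤ 1 / (6 * N)} ⊆
      {p | ((N / 2 : ℝ) ^ d) ^ 2 ≤ ‖dirichletKernel d N (p.1 - p.2)‖ ^ 2} := fun p hp => by
    have hdist : ‖p.1 - p.2‖ ≤ 1 / (6 * N) := dist_eq_norm p.1 p.2 ▸ hp
    exact pow_le_pow_left₀ (by positivity) (half_pow_le_norm_dirichletKernel hdist) 2
  refine (mul_le_mul_of_nonneg_left (measureReal_mono hsub) (by positivity)).trans ?_
  exact mul_meas_ge_le_integral_of_nonneg (ae_of_all _ fun p => by positivity)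
    (hcont.integrable_of_hasCompactSupport (HasCompactSupport.of_compactSpace _)) _

theorem exists_measureReal_prod_dist_le_inv_natCast {s t : ℝ} (hs : 0 ≤ s) (htd : t ≤ d)
    (hts : t < s) (h : fourierSeminorm s μ < ∞) :
    ∃ C, 0 ≤ C ∧ ∀ N : ℕ, 0 < N →
      (μ.prod μ).real {p | dist p.1 p.2 ≤ 1 / (6 * N)} ≤ C * (N : ℝ) ^ (-t) := by
  obtain ⟨C, hC, hint⟩ := exists_integral_norm_dirichletKernel_sub_sq_le hs htd hts h
  refine ⟨C * (2 ^ d) ^ 2, by positivity, fun N hN => ?_⟩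
  have hN0 : (0 : ℝ) < N := by exact_mod_cast hN
  have hle := (pow_mul_measureReal_prod_dist_le_integral N).trans (hint N hN)
  have hpow : (N : ℝ) ^ (2 * d - t) = ((N : ℝ) ^ d) ^ 2 * (N : ℝ) ^ (-t) := by
    rw [← pow_mul, ← Real.rpow_natCast, ← Real.rpow_add hN0]
    congr 1
    push_cast
    ring
  rw [← le_div_iff₀' (by positivity), hpow] at hle
  refine hle.trans_eq ?_
  rw [div_pow]
  field_simp

theorem exists_nat_le_one_div_and_inv_le {r : ℝ} (hr : 0 < r) (hr6 : r ≤ 1 / 6) :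
    ∃ N : ℕ, 0 < N ∧ r ≤ 1 / (6 * N) ∧ (N : ℝ)⁻¹ ≤ 12 * r := by
  have hN : 0 < ⌊1 / (6 * r)⌋₊ :=
    Nat.floor_pos.2 (by rw [le_div_iff₀ (by positivity)]; linarith)
  have hle : (⌊1 / (6 * r)⌋₊ : ℝ) ≤ 1 / (6 * r) := Nat.floor_le (by positivity)
  have hlt : 1 / (6 * r) < ⌊1 / (6 * r)⌋₊ + 1 := Nat.lt_floor_add_one _
  set N := ⌊1 / (6 * r)⌋₊
  have hone : (1 : ℝ) ≤ N := by exact_mod_cast hN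
  refine ⟨N, hN, ?_, ?_⟩
  · rw [le_div_iff₀ (by positivity)] at hle ⊢
    linarith
  · rw [div_lt_iff₀ (by positivity)] at hlt
    rw [inv_le_iff_one_le_mul₀ (by positivity)]
    nlinarith

theorem exists_measure_prod_dist_le {s t : ℝ} (ht : 0 ≤ t) (htd : t ≤ d) (hts : t < s)
    (h : fourierSeminorm s μ < ∞) : ∃ C, ∀ r : ℝ, 0 < r →
      (μ.prod μ) {p | dist p.1 p.2 ≤ r} ≤ ENNReal.ofReal (C * r ^ t) := by
  obtain ⟨C, hC, hcorr⟩ := exists_measureReal_prod_dist_le_inv_natCast (ht.trans hts.le) htd hts h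
  refine ⟨max (C * 12 ^ t) ((μ.prod μ).real Set.univ * 6 ^ t), fun r hr => ?_⟩
  rw [← ofReal_measureReal]
  refine ENNReal.ofReal_le_ofReal ?_
  rcases le_or_gt r (1 / 6) with hr6 | hr6
  · obtain ⟨N, hN, hrN, hNr⟩ := exists_nat_le_one_div_and_inv_le hr hr6
    calc (μ.prod μ).real {p | dist p.1 p.2 ≤ r}
        ≤ (μ.prod μ).real {p | dist p.1 p.2 ≤ 1 / (6 * N)} :=
          measureReal_mono fun p hp => le_trans hp hrN
      _ ≤ C * (N : ℝ)⁻¹ ^ t := by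
          rw [Real.inv_rpow N.cast_nonneg, ← Real.rpow_neg N.cast_nonneg]
          exact hcorr N hN
      _ ≤ C * (12 * r) ^ t := by gcongr
      _ = C * 12 ^ t * r ^ t := by rw [Real.mul_rpow (by norm_num) hr.le, mul_assoc]
      _ ≤ _ := by gcongr; exact le_max_left _ _
  · calc (μ.prod μ).real {p | dist p.1 p.2 ≤ r} ≤ (μ.prod μ).real Set.univ :=
          measureReal_mono (Set.subset_univ _)
      _ ≤ (μ.prod μ).real Set.univ * (6 * r) ^ t :=
          le_mul_of_one_le_right measureReal_nonneg (Real.one_le_rpow (by linarith) ht)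
      _ = ((μ.prod μ).real Set.univ * 6 ^ t) * r ^ t := by
          rw [Real.mul_rpow (by norm_num) hr.le, mul_assoc]
      _ ≤ _ := by gcongr; exact le_max_right _ _

end CorrelationDecay

section FourierDimension

variable {d : ℕ}

theorem ofReal_le_dimH_of_fourierSeminorm_lt_top {μ : Measure (Torus d)} [IsFiniteMeasure μ]
    {s : ℝ} (hsd : s ≤ d) (h : fourierSeminorm s μ < ∞) {E : Set (Torus d)} (hE : μ E ≠ 0) :
    ENNReal.ofReal s ≤ dimH E := by
  refine le_of_forall_lt_imp_le_of_dense fun t ht => ?_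
  lift t to ℝ≥0 using ht.ne_top
  have hts : (t : ℝ) < s := (ENNReal.lt_ofReal_iff_toReal_lt ENNReal.coe_ne_top).1 ht
  rcases eq_or_ne t 0 with rfl | ht0
  · simp
  obtain ⟨q, htq, hqs⟩ := exists_between hts
  have hpos : (0 : ℝ) < t := by positivity
  obtain ⟨C, hC⟩ := exists_measure_prod_dist_le (hpos.trans htq).le (hqs.le.trans hsd) hqs h
  exact coe_le_dimH_of_lintegral_rieszPotential_ne_top
    (lintegral_rieszPotential_lt_top_of_measure_dist_le hpos htq hC).ne hE

theorem fourierDim_le_dimH (E : Set (Torus d)) : fourierDim E ≤ dimH E := by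
  refine iSup₂_le fun μ hμ => iSup₂_le fun s hs => ?_
  have := hμ.1
  have hE : μ E = 1 := by
    rw [measure_congr (eventuallyEq_univ.2 (mem_of_superset Measure.support_mem_ae hμ.2)),
      measure_univ]
  simpa using ofReal_le_dimH_of_fourierSeminorm_lt_top (s := s) (by exact_mod_cast hs.1) hs.2
    (hE.trans_ne one_ne_zero)

theorem ofReal_le_fourierDim {β : ℝ} (hβ : β ≤ d) (p : XSpace d β) :
    ENNReal.ofReal β ≤ fourierDim (p.1.1 : Set (Torus d)) := by
  refine le_of_forall_lt_imp_le_of_dense fun s hs => ?_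
  lift s to ℝ≥0 using hs.ne_top
  have hsβ : (s : ℝ) < β := (ENNReal.lt_ofReal_iff_toReal_lt ENNReal.coe_ne_top).1 hs
  have hsd : s ≤ d := by exact_mod_cast hsβ.le.trans hβ
  exact le_iSup₂_of_le p.1.2.1 p.2 <|
    le_iSup₂_of_le (f := fun (s : ℝ≥0) _ => (s : ℝ≥0∞)) s
      ⟨hsd, p.1.2.2.2 s s.2 hsβ⟩ le_rfl

end FourierDimension

end SalemGeneric

end

theorem mainTheorem6 (d : ℕ) (β : ℝ) (hβ_pos : 0 < β) (hβ_le : β ≤ d) :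
    ∀ᶠ p : SalemGeneric.XSpace d β in residual (SalemGeneric.XSpace d β),
      SalemGeneric.IsSalem (p.1.1 : Set (SalemGeneric.Torus d)) ∧
        dimH (p.1.1 : Set (SalemGeneric.Torus d)) = ENNReal.ofReal β := by
  filter_upwards [SalemGeneric.eventually_residual_dimH_le hβ_pos] with p hupper
  have hlower := SalemGeneric.ofReal_le_fourierDim hβ_le p
  have hle := SalemGeneric.fourierDim_le_dimH (p.1.1 : Set (SalemGeneric.Torus d))
  exact ⟨le_antisymm hle (hupper.trans hlower), le_antisymm hupper (hlower.trans hle)⟩
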